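/- Let $X$ be a $d$-regular tree with $d\ge 3$, and let a group $G$ act on $X$ isometrically (by graph automorphisms) and properly, i.e. $\{g\in G: d(x,gx)\le r\}$ is finite for every vertex $x$ and every $r\ge 0$. The quotient graph $X/G$ has as vertices and oriented edges the $G$-orbits of vertices and of oriented edges of $X$; it may have loops, multiple edges and half-edges (oriented edges equal to their own reverse). Assume that 1. $X/G$ is $d$-regular, i.e. exactly $d$ oriented edges of $X/G$ start at each of its vertices; 2. $X/G$ has infinitely many vertices; 3. $X/G$ is amenable, i.e. $\inf_A \frac{1}{d}\frac{|\partial A|}{|A|}=0$, where $A$ runs over the nonempty finite sets of vertices of $X/G$ and $\partial A$ is the set of edges joining a vertex of $A$ to a vertex outside $A$. Fix a vertex $o$ of $X$. Identify the boundary $\partial X$ with the set of geodesic rays issuing from $o$, with the visual metric $\rho(\alpha,\beta)=e^{-n}$ for $\alpha\neq\beta$, where $n$ is the length of $\alpha\cap\beta$. The limit set $\Lambda G\subset\partial X$ consists of the accumulation points of the orbit $Go$. A limit point $\xi$ is conical if there are $R>0$ and $g_n\in G$ such that $g_no\to\xi$ and every $g_no$ lies within distance $R$ of the geodesic ray $[o,\xi)$.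 Let $\Lambda^{nc}G$ be the set of limit points that are not conical. Then $$\mathrm{Hdim}(\Lambda^{nc}G)=\log(d-1).$$ -/

import Mathlib

/-- A graph in the sense of Serre: `E` is the set of oriented edges, `rev` reverses the orientation.
Loops and multiple edges are allowed, and so are half-edges (`rev e = e`). -/
structure OrientedMultigraph.{u} where
  V : Type u
  E : Type u
  src : E → V
  tgt : E → V
  rev : E → E
  rev_rev : ∀ e, rev (rev e) = e
  src_rev : ∀ e, src (rev e) = tgt e

namespace OrientedMultigraph

/-- Every vertex is the origin of exactly `d` oriented edges (for `d ≥ 1`).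
Thus a loop contributes `2` to the degree and a half-edge contributes `1`. -/
def IsRegularOfDegree (Γ : OrientedMultigraph) (d : ℕ) : Prop :=
  ∀ v : Γ.V, Nat.card {e : Γ.E // Γ.src e = v} = d

/-- The edges joining a vertex of `A` to a vertex outside `A`, each listed once, with the
orientation that leaves `A`. -/
def edgeBoundary (Γ : OrientedMultigraph) (A : Finset Γ.V) : Set Γ.E :=
  {e | Γ.src e ∈ A ∧ Γ.tgt e ∉ A}

/-- The isoperimetric constant `inf_A |∂A| / (d |A|)` of a graph of degree `d`; `A` runs over the
nonempty finite sets of vertices. -/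
noncomputable def isoperimetricConstant (Γ : OrientedMultigraph) (d : ℕ) : ℝ :=
  ⨅ A : {A : Finset Γ.V // A.Nonempty},
    (1 / (d : ℝ)) * (((Γ.edgeBoundary A.1).ncard : ℝ) / (A.1.card : ℝ))

/-- Amenability of an infinite graph that is regular of degree `d`: zero isoperimetric constant. -/
def IsAmenable (Γ : OrientedMultigraph) (d : ℕ) : Prop :=
  Γ.isoperimetricConstant d = 0

end OrientedMultigraph

section Quotient

variable {V : Type*} (X : SimpleGraph V) (G : Type*) [Group G] [MulAction G V]

/-- Two oriented edges of `X` are equivalent if they lie in the same orbit of `G`. -/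
def dartOrbitRel : Setoid X.Dart where
  r e f := ∃ g : G, g • e.fst = f.fst ∧ g • e.snd = f.snd
  iseqv :=
    { refl := fun e => ⟨1, one_smul _ _, one_smul _ _⟩
      symm := by
        rintro e f ⟨g, h₁, h₂⟩
        exact ⟨g⁻¹, by rw [← h₁, inv_smul_smul], by rw [← h₂, inv_smul_smul]⟩
      trans := by
        rintro e f k ⟨g, h₁, h₂⟩ ⟨g', h₃, h₄⟩
        exact ⟨g' * g, by rw [mul_smul, h₁, h₃], by rw [mul_smul, h₂, h₄]⟩ }

/-- The quotient graph `X / G`: its vertices and oriented edges are the `G`-orbits of the vertices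
and of the oriented edges of `X`. -/
def quotientGraph : OrientedMultigraph where
  V := MulAction.orbitRel.Quotient G V
  E := Quotient (dartOrbitRel X G)
  src := Quotient.lift (fun e => Quotient.mk (MulAction.orbitRel G V) e.fst) (by
    rintro e f ⟨g, h₁, -⟩
    exact Quotient.sound ((MulAction.orbitRel G V).symm ⟨g, h₁⟩))
  tgt := Quotient.lift (fun e => Quotient.mk (MulAction.orbitRel G V) e.snd) (by
    rintro e f ⟨g, -, h₂⟩
    exact Quotient.sound ((MulAction.orbitRel G V).symm ⟨g, h₂⟩))
  rev := Quotient.map (fun e => e.symm) (by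
    rintro e f ⟨g, h₁, h₂⟩
    exact ⟨g, h₂, h₁⟩)
  rev_rev := by
    rintro ⟨e⟩
    exact congrArg (Quotient.mk _) e.symm_symm
  src_rev := by
    rintro ⟨e⟩
    rfl

/-- The action of `G` is by isometries, that is, by automorphisms of the graph. -/
def ActsByAutomorphisms : Prop :=
  ∀ (g : G) (u v : V), X.Adj (g • u) (g • v) ↔ X.Adj u v

/-- The action of `G` is (metrically) proper. -/
def ActsProperly : Prop :=
  ∀ (x : V) (r : ℕ), {g : G | X.dist x (g • x) ≤ r}.Finite

end Quotient

/-- Geodesic rays in `X` issuing from `o`. For a tree `X` this is the Gromov boundary (the space of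
ends) of `X`, seen from `o`. -/
@[ext]
structure GeodesicRay {V : Type*} (X : SimpleGraph V) (o : V) where
  vertex : ℕ → V
  vertex_zero : vertex 0 = o
  dist_vertex : ∀ m k : ℕ, X.dist (vertex m) (vertex (m + k)) = k

namespace GeodesicRay

variable {V : Type*} {X : SimpleGraph V} {o : V}

/-- The length of the common initial segment of two distinct rays from `o`. -/
noncomputable def commonLength (ξ η : GeodesicRay X o) : ℕ :=
  sInf {n | ξ.vertex (n + 1) ≠ η.vertex (n + 1)}

theorem exists_ne_of_ne {ξ η : GeodesicRay X o} (h : ξ ≠ η) :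
    ∃ n, ξ.vertex (n + 1) ≠ η.vertex (n + 1) := by
  by_contra! hc
  apply h
  ext n
  cases n with
  | zero => rw [ξ.vertex_zero, η.vertex_zero]
  | succ n => exact hc n

theorem commonLength_comm (ξ η : GeodesicRay X o) : commonLength ξ η = commonLength η ξ := by
  simp only [commonLength, ne_comm]

theorem min_commonLength_le {ξ η ζ : GeodesicRay X o} (h : ξ ≠ ζ) :
    min (commonLength ξ η) (commonLength η ζ) ≤ commonLength ξ ζ := by
  by_contra! hc
  obtain ⟨h₁, h₂⟩ := lt_min_iff.1 hc
  have h₃ : ξ.vertex (commonLength ξ ζ + 1) ≠ ζ.vertex (commonLength ξ ζ + 1) :=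
    Nat.sInf_mem (s := {n | ξ.vertex (n + 1) ≠ ζ.vertex (n + 1)}) (exists_ne_of_ne h)
  have h₄ := Nat.notMem_of_lt_sInf h₁
  have h₅ := Nat.notMem_of_lt_sInf h₂
  simp only [Set.mem_ofPred_eq, not_not] at h₄ h₅
  exact h₃ (h₄.trans h₅)

open Classical in
/-- The visual metric: `exp (-n)`, where `n` is the length of the intersection of the two rays. -/
noncomputable def visualDist (ξ η : GeodesicRay X o) : ℝ :=
  if ξ = η then 0 else Real.exp (-(commonLength ξ η : ℝ))

theorem visualDist_nonneg (ξ η : GeodesicRay X o) : 0 ≤ visualDist ξ η := by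
  unfold visualDist
  split_ifs
  · exact le_rfl
  · exact (Real.exp_pos _).le

theorem visualDist_le_max (ξ η ζ : GeodesicRay X o) :
    visualDist ξ ζ ≤ max (visualDist ξ η) (visualDist η ζ) := by
  by_cases h : ξ = ζ
  · have h₀ : visualDist ξ ζ = 0 := by simp [visualDist, h]
    rw [h₀]
    exact le_max_of_le_left (visualDist_nonneg _ _)
  by_cases h₁ : ξ = η
  · subst h₁
    exact le_max_right _ _
  by_cases h₂ : η = ζ
  · subst h₂
    exact le_max_left _ _
  have key := min_commonLength_le (η := η) h
  simp only [visualDist, h, h₁, h₂, if_false, le_max_iff, Real.exp_le_exp, neg_le_neg_iff,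
    Nat.cast_le]
  exact min_le_iff.1 key

noncomputable instance : MetricSpace (GeodesicRay X o) where
  dist := visualDist
  dist_self ξ := by simp [visualDist]
  dist_comm ξ η := by
    unfold visualDist
    rw [commonLength_comm ξ η]
    congr 1
    exact propext eq_comm
  dist_triangle ξ η ζ := by
    refine (visualDist_le_max ξ η ζ).trans (max_le ?_ ?_)
    · exact le_add_of_nonneg_right (visualDist_nonneg _ _)
    · exact le_add_of_nonneg_left (visualDist_nonneg _ _)
  eq_of_dist_eq_zero := by
    intro ξ η h
    by_contra hne
    have h' : visualDist ξ η = 0 := h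
    rw [visualDist, if_neg hne] at h'
    exact (Real.exp_pos _).ne' h'

/-- A sequence of vertices of a tree converges to the end of `ξ`: each vertex of `ξ` lies on the
geodesic from `o` to `x n` for all large `n`. -/
def IsLimit (x : ℕ → V) (ξ : GeodesicRay X o) : Prop :=
  ∀ k : ℕ, ∀ᶠ n in Filter.atTop,
    X.dist o (ξ.vertex k) + X.dist (ξ.vertex k) (x n) = X.dist o (x n)

end GeodesicRay

section LimitSets

variable {V : Type*} (X : SimpleGraph V) (G : Type*) [Group G] [MulAction G V] (o : V)

/-- The limit set: the accumulation points in the boundary of the orbit of `o`. -/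
def limitSet : Set (GeodesicRay X o) :=
  {ξ | ∃ g : ℕ → G, ξ.IsLimit (fun n => g n • o)}

/-- The conical limit set: the limits of sequences in the orbit of `o` that stay within bounded
distance of the ray. -/
def conicalLimitSet : Set (GeodesicRay X o) :=
  {ξ | ∃ g : ℕ → G, ξ.IsLimit (fun n => g n • o) ∧
    ∃ R : ℕ, ∀ n, ∃ k, X.dist (g n • o) (ξ.vertex k) ≤ R}

/-- The non-conical limit set. -/
def nonconicalLimitSet : Set (GeodesicRay X o) :=
  limitSet X G o \ conicalLimitSet X G o

end LimitSets

/-!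
The upper bound holds for the whole boundary: it is covered by the cylinders over the sphere of
radius `n + 1` about `o`, which has at most `d * (d - 1) ^ n` vertices.

For the lower bound let `Γ = X / G`. Because `X` is a tree, the lifts of the non-backtracking walks
in `Γ` that start below `o` are geodesic rays from `o`. Such a ray is not conical if the walk leaves
every finite set of vertices, and it is a limit point if at arbitrarily late times the walk could be
continued, without backtracking, to the vertex below `o`. So it suffices, for each
`s < log (d - 1)`, to construct sufficiently many walks of this kind.

* *An amenable end.* If a connected amenable set of vertices of `Γ` loses a vertex, then one of the
  finitely many remaining components is amenable. Hence there are nested connected amenable sets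
  `U n` that avoid larger and larger balls (`exists_amenable_end`).
* *Entropy in a Følner set.* A smallest finite subset `A` of `U n` with given small isoperimetric
  ratio induces a subgraph of minimal degree at least two in which almost all oriented edges lead to
  vertices of degree `d`. The non-backtracking random walk on this subgraph preserves the counting
  measure on the oriented edges, so Jensen's inequality bounds the number of walks of length `L`
  below by `exp (c * L)`, where `c`, the mean of `log (deg - 1)`, is close to `log (d - 1)`.
  Stationarity also makes the walk recurrent, which allows one to close up the walks
  (`IsBalanced.exists_closed_walks`) and, since they branch, to turn them around
  (`IsAmenableSet.exists_closed_walks`). The edges found in this way are reversible, and between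
  reversible edges there are always non-backtracking walks (`IsReversible.reach`); likewise they
  permit the return to the vertex below `o`.
* *Concatenation.* Closed walks in `U 0`, `U 1`, … are concatenated, with transitions in between,
  each family being used for so long that the next transition and closed walk have no influence
  on the growth rate (`exists_coding`). The resulting rays are parametrized by binary sequences, and
  the binary expansion is an `s`-Hölder map from the set of rays onto the unit interval
  (`le_dimH_of_coding`), so that this set has dimension at least `s`.
-/

/-! ### Walks along a relation -/

section Walks

variable {α : Type*} {R R' : α → α → Prop}

/-- `IsWalk R a l b`: the list `l` is the sequence of the vertices that a walk along `R` from `a`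
to `b` visits after `a`. -/
def IsWalk (R : α → α → Prop) : α → List α → α → Prop
  | a, [], b => a = b
  | a, c :: l, b => R a c ∧ IsWalk R c l b

theorem IsWalk.append {a b c : α} {l l' : List α} (h : IsWalk R a l b) (h' : IsWalk R b l' c) :
    IsWalk R a (l ++ l') c := by
  induction l generalizing a with
  | nil => cases h; exact h'
  | cons x l ih => exact ⟨h.1, ih h.2⟩

theorem IsWalk.mono (hR : ∀ a b, R a b → R' a b) {a b : α} {l : List α} (h : IsWalk R a l b) :
    IsWalk R' a l b := by
  induction l generalizing a with
  | nil => exact h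
  | cons x l ih => exact ⟨hR _ _ h.1, ih h.2⟩

theorem IsWalk.reflTransGen {a b : α} {l : List α} (h : IsWalk R a l b) :
    Relation.ReflTransGen R a b := by
  induction l generalizing a with
  | nil => cases h; exact .refl
  | cons x l ih => exact .head h.1 (ih h.2)

theorem exists_isWalk {a b : α} (h : Relation.ReflTransGen R a b) : ∃ l, IsWalk R a l b := by
  induction h using Relation.ReflTransGen.head_induction_on with
  | refl => exact ⟨[], rfl⟩
  | head h _ ih =>
    obtain ⟨l, hl⟩ := ih
    exact ⟨_ :: l, h, hl⟩

theorem IsWalk.rel_getElem {a b : α} {l : List α} (h : IsWalk R a l b) (i : ℕ)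
    (hi : i < l.length) : R ((a :: l)[i]'(by simp; omega)) (l[i]) := by
  induction l generalizing a i with
  | nil => simp at hi
  | cons x l ih =>
    cases i with
    | zero => exact h.1
    | succ i => exact ih h.2 i (by simpa using hi)

theorem IsWalk.getElem_length {a b : α} {l : List α} (h : IsWalk R a l b) :
    (a :: l)[l.length]'(by simp) = b := by
  induction l generalizing a with
  | nil => exact h
  | cons x l ih => exact ih h.2

end Walks

/-! ### Counting walks in a finite directed graph with balanced degrees -/

section Counting

open Classical in
/-- The successors of `a` in the finite set `H`. -/
noncomputable def successors {α : Type*} (H : Finset α) (R : α → α → Prop) (a : α) : Finset α :=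
  H.filter (R a)

open Classical in
/-- The predecessors of `a` in the finite set `H`. -/
noncomputable def predecessors {α : Type*} (H : Finset α) (R : α → α → Prop) (a : α) : Finset α :=
  H.filter (R · a)

/-- A relation on a finite set without dead ends such that all predecessors of `b` have as many
successors as `b` has predecessors. The simple random walk along such a relation preserves the
counting measure. -/
structure IsBalanced {α : Type*} (H : Finset α) (R : α → α → Prop) : Prop where
  left_mem : ∀ {a b}, R a b → a ∈ H
  right_mem : ∀ {a b}, R a b → b ∈ H
  exists_succ : ∀ a ∈ H, ∃ b, R a b
  exists_pred : ∀ b ∈ H, ∃ a, R a b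
  card_eq : ∀ {a b}, R a b → (successors H R a).card = (predecessors H R b).card

variable {α : Type*} {H : Finset α} {R : α → α → Prop}

namespace IsBalanced

theorem mem_successors (h : IsBalanced H R) {a b : α} : b ∈ successors H R a ↔ R a b := by
  simp only [successors, Finset.mem_filter, and_iff_right_iff_imp]
  exact h.right_mem

theorem mem_predecessors (h : IsBalanced H R) {a b : α} : a ∈ predecessors H R b ↔ R a b := by
  simp only [predecessors, Finset.mem_filter, and_iff_right_iff_imp]
  exact h.left_mem

theorem card_successors_pos (h : IsBalanced H R) {a : α} (ha : a ∈ H) :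
    0 < (successors H R a).card := by
  obtain ⟨b, hb⟩ := h.exists_succ a ha
  exact Finset.card_pos.2 ⟨b, h.mem_successors.2 hb⟩

/-- The counting measure on `H` is stationary for the random walk that moves to a uniformly chosen
successor. -/
theorem sum_average_successors (h : IsBalanced H R) (g : α → ℝ) :
    ∑ a ∈ H, (∑ b ∈ successors H R a, g b) / (successors H R a).card = ∑ b ∈ H, g b := by
  classical
  have h₁ : ∀ a ∈ H, (∑ b ∈ successors H R a, g b) / (successors H R a).card =
      ∑ b ∈ successors H R a, g b / (predecessors H R b).card := by
    intro a _
    rw [Finset.sum_div]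
    refine Finset.sum_congr rfl fun b hb => ?_
    rw [h.card_eq (h.mem_successors.1 hb)]
  rw [Finset.sum_congr rfl h₁, Finset.sum_comm' (t' := H) (s' := fun b => predecessors H R b)]
  · refine Finset.sum_congr rfl fun b hb => ?_
    obtain ⟨a, ha⟩ := h.exists_pred b hb
    have hpos : 0 < (predecessors H R b).card :=
      Finset.card_pos.2 ⟨a, h.mem_predecessors.2 ha⟩
    rw [Finset.sum_const, nsmul_eq_mul]
    field_simp
  · intro a b
    rw [h.mem_successors, h.mem_predecessors]
    exact ⟨fun hab => ⟨hab.2, h.right_mem hab.2⟩, fun hab => ⟨h.left_mem hab.1, hab.1⟩⟩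

/-- Poincaré recurrence for the stationary counting measure: no step leads into a set that is
closed under successors from outside of it. -/
theorem reflTransGen_of_rel (h : IsBalanced H R) {a b : α} (hab : R a b) :
    Relation.ReflTransGen R b a := by
  classical
  by_contra hba
  let g : α → ℝ := fun x => if Relation.ReflTransGen R b x then 1 else 0
  have hg : ∀ x, 0 ≤ g x := fun x => by positivity
  have hle : ∀ x ∈ H, g x ≤ (∑ y ∈ successors H R x, g y) / (successors H R x).card := by
    intro x hx
    by_cases hbx : Relation.ReflTransGen R b x
    · have : ∑ y ∈ successors H R x, g y = (successors H R x).card := by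
        rw [Finset.sum_congr rfl (g := fun _ => (1 : ℝ)), Finset.sum_const, nsmul_eq_mul, mul_one]
        exact fun y hy => if_pos (hbx.tail (h.mem_successors.1 hy))
      have hpos := h.card_successors_pos hx
      rw [this, div_self (by positivity)]
      exact (if_pos hbx).le
    · rw [show g x = 0 from if_neg hbx]
      exact div_nonneg (Finset.sum_nonneg fun y _ => hg y) (Nat.cast_nonneg _)
  have hlt : g a < (∑ y ∈ successors H R a, g y) / (successors H R a).card := by
    rw [show g a = 0 from if_neg hba]
    have hpos := h.card_successors_pos (h.left_mem hab)
    refine div_pos (Finset.sum_pos' (fun y _ => hg y) ⟨b, h.mem_successors.2 hab, ?_⟩)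
      (by positivity)
    rw [show g b = 1 from if_pos .refl]
    exact one_pos
  exact (Finset.sum_lt_sum hle ⟨a, h.left_mem hab, hlt⟩).ne' (h.sum_average_successors g)

theorem reflTransGen_symm (h : IsBalanced H R) {a b : α} (hab : Relation.ReflTransGen R a b) :
    Relation.ReflTransGen R b a := by
  induction hab with
  | refl => exact .refl
  | tail _ hbc ih => exact (h.reflTransGen_of_rel hbc).trans ih

end IsBalanced

open Classical in
/-- The walks of a given length from `a`, encoded as in `IsWalk`. -/
noncomputable def walksFrom (H : Finset α) (R : α → α → Prop) : ℕ → α → Finset (List α)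
  | 0, _ => {[]}
  | n + 1, a => (successors H R a).biUnion fun b => (walksFrom H R n b).image (List.cons b)

theorem card_walksFrom_succ (n : ℕ) (a : α) :
    (walksFrom H R (n + 1) a).card = ∑ b ∈ successors H R a, (walksFrom H R n b).card := by
  classical
  rw [walksFrom, Finset.card_biUnion]
  · exact Finset.sum_congr rfl fun b _ =>
      Finset.card_image_of_injective _ (List.cons_injective)
  · intro b _ c _ hbc
    rw [Function.onFun, Finset.disjoint_left]
    intro l hb hc
    obtain ⟨l₁, -, rfl⟩ := Finset.mem_image.1 hb
    obtain ⟨l₂, -, h⟩ := Finset.mem_image.1 hc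
    exact hbc (List.cons.inj h).1.symm

namespace IsBalanced

theorem isWalk_of_mem_walksFrom (h : IsBalanced H R) {n : ℕ} {a : α} (ha : a ∈ H) {l : List α}
    (hl : l ∈ walksFrom H R n a) : l.length = n ∧ ∃ b ∈ H, IsWalk R a l b := by
  classical
  induction n generalizing a l with
  | zero =>
    rw [walksFrom, Finset.mem_singleton] at hl
    subst hl
    exact ⟨rfl, a, ha, rfl⟩
  | succ n ih =>
    rw [walksFrom, Finset.mem_biUnion] at hl
    obtain ⟨b, hb, hl⟩ := hl
    obtain ⟨l', hl', rfl⟩ := Finset.mem_image.1 hl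
    have hab := h.mem_successors.1 hb
    obtain ⟨h₁, c, hc, h₂⟩ := ih (h.right_mem hab) hl'
    exact ⟨by simp [h₁], c, hc, hab, h₂⟩

theorem card_walksFrom_pos (h : IsBalanced H R) (n : ℕ) {a : α} (ha : a ∈ H) :
    0 < (walksFrom H R n a).card := by
  induction n generalizing a with
  | zero => simp [walksFrom]
  | succ n ih =>
    rw [card_walksFrom_succ]
    obtain ⟨b, hb⟩ := h.exists_succ a ha
    exact Finset.sum_pos (fun c hc => ih (h.right_mem (h.mem_successors.1 hc)))
      ⟨b, h.mem_successors.2 hb⟩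

/-- Jensen's inequality for one step of the random walk, iterated by means of stationarity. -/
theorem sum_log_card_walksFrom (h : IsBalanced H R) (n : ℕ) :
    n * ∑ a ∈ H, Real.log (successors H R a).card ≤
      ∑ a ∈ H, Real.log (walksFrom H R n a).card := by
  induction n with
  | zero => simp [walksFrom]
  | succ n ih =>
    have key : ∀ a ∈ H, Real.log (successors H R a).card +
        (∑ b ∈ successors H R a, Real.log (walksFrom H R n b).card) / (successors H R a).card ≤
        Real.log (walksFrom H R (n + 1) a).card := by
      intro a ha
      set S := successors H R a
      have hpos : (0 : ℝ) < S.card := by exact_mod_cast h.card_successors_pos ha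
      have hw : ∀ b ∈ S, (0 : ℝ) < (walksFrom H R n b).card := fun b hb => by
        exact_mod_cast h.card_walksFrom_pos n (h.right_mem (h.mem_successors.1 hb))
      have hJ := strictConcaveOn_log_Ioi.concaveOn.le_map_sum (t := S)
        (w := fun _ => (S.card : ℝ)⁻¹) (p := fun b => ((walksFrom H R n b).card : ℝ))
        (fun _ _ => by positivity) (by rw [Finset.sum_const, nsmul_eq_mul]; field_simp)
        (fun b hb => hw b hb)
      simp only [smul_eq_mul, ← Finset.mul_sum] at hJ
      obtain ⟨b, hb⟩ := h.exists_succ a ha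
      have hsum : (0 : ℝ) < ∑ b ∈ S, ((walksFrom H R n b).card : ℝ) :=
        Finset.sum_pos hw ⟨b, h.mem_successors.2 hb⟩
      rw [Real.log_mul (by positivity) hsum.ne', Real.log_inv] at hJ
      rw [card_walksFrom_succ, Nat.cast_sum, div_eq_inv_mul]
      linarith
    have := Finset.sum_le_sum key
    rw [Finset.sum_add_distrib,
      h.sum_average_successors fun b => Real.log (walksFrom H R n b).card] at this
    push_cast
    linarith

theorem card_walksFrom_eq_one (h : IsBalanced H R) (n : ℕ) {a : α} (ha : a ∈ H)
    (hdet : ∀ b, Relation.ReflTransGen R a b → (successors H R b).card ≤ 1) :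
    (walksFrom H R n a).card = 1 := by
  induction n generalizing a with
  | zero => simp [walksFrom]
  | succ n ih =>
    rw [card_walksFrom_succ]
    have h₁ : (successors H R a).card = 1 :=
      le_antisymm (hdet a .refl) (h.card_successors_pos ha)
    rw [Finset.sum_congr rfl (g := fun _ => 1), Finset.sum_const, h₁, smul_eq_mul, mul_one]
    intro b hb
    have hab := h.mem_successors.1 hb
    exact ih (h.right_mem hab) fun c hc => hdet c (.head hab hc)

/-- If the logarithms of the numbers of successors have mean at least `c`, then, for every
`s < c`, some vertex carries closed walks of one length `L` that encode more than
`s * L / log 2` bits. -/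
theorem exists_closed_walks (h : IsBalanced H R) (hne : H.Nonempty) {c s : ℝ} (hs : 0 ≤ s)
    (hsc : s < c) (hc : c * H.card ≤ ∑ a ∈ H, Real.log (successors H R a).card) :
    ∃ a ∈ H, (∃ b, Relation.ReflTransGen R a b ∧ 1 < (successors H R b).card) ∧
      ∃ (L m : ℕ) (B : (Fin m → Fin 2) → List α), s * L < m * Real.log 2 ∧
        Function.Injective B ∧ ∀ x, (B x).length = L ∧ IsWalk R a (B x) a := by
  classical
  have hH : (0 : ℝ) < H.card := by exact_mod_cast Finset.card_pos.2 hne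
  -- Return walks `r a b` from `b` to `a`; their lengths are bounded by `D`, independently of `L`.
  have hr : ∀ a b, ∃ l, Relation.ReflTransGen R b a → IsWalk R b l a := by
    intro a b
    by_cases hba : Relation.ReflTransGen R b a
    · obtain ⟨l, hl⟩ := exists_isWalk hba
      exact ⟨l, fun _ => hl⟩
    · exact ⟨[], fun h => absurd h hba⟩
  choose r hr using hr
  obtain ⟨D, hD⟩ : ∃ D : ℕ, ∀ a ∈ H, ∀ b ∈ H, (r a b).length ≤ D :=
    ⟨(H ×ˢ H).sup fun p => (r p.1 p.2).length, fun a ha b hb =>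
      Finset.le_sup (f := fun p : α × α => (r p.1 p.2).length) (b := (a, b))
        (Finset.mem_product.2 ⟨ha, hb⟩)⟩
  obtain ⟨L, hL⟩ := exists_nat_gt ((Real.log H.card + Real.log 2 + s * D) / (c - s))
  rw [div_lt_iff₀ (by linarith)] at hL
  have hlogH : 0 ≤ Real.log H.card := Real.log_natCast_nonneg _
  have hlog2 : 0 < Real.log 2 := Real.log_pos one_lt_two
  have hsD : 0 ≤ s * D := by positivity
  obtain ⟨a, ha, hLa⟩ : ∃ a ∈ H, c * L ≤ Real.log (walksFrom H R L a).card := by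
    by_contra! hlt
    have h₁ := Finset.sum_lt_sum_of_nonempty hne hlt
    rw [Finset.sum_const, nsmul_eq_mul] at h₁
    have h₂ := h.sum_log_card_walksFrom L
    have h₃ := mul_le_mul_of_nonneg_left hc (Nat.cast_nonneg (α := ℝ) L)
    nlinarith
  have hcL : 0 < c * L := by nlinarith [Nat.cast_nonneg (α := ℝ) L]
  refine ⟨a, ha, ?_, ?_⟩
  · by_contra! hdet
    rw [h.card_walksFrom_eq_one L ha hdet] at hLa
    simp at hLa
    linarith
  -- By pigeonhole many of the walks have the same endpoint `b`.
  let last : List α → α := fun l => if hl : ∃ b ∈ H, IsWalk R a l b then hl.choose else a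
  have hlast : ∀ l ∈ walksFrom H R L a, last l ∈ H ∧ IsWalk R a l (last l) := by
    intro l hl
    have hex := (h.isWalk_of_mem_walksFrom ha hl).2
    simp only [last, dif_pos hex]
    exact hex.choose_spec
  obtain ⟨b, hb, hcard⟩ := Finset.exists_le_card_fiber_of_nsmul_le_card_of_maps_to
    (s := walksFrom H R L a) (t := H) (f := last) (b := ((walksFrom H R L a).card : ℝ) / H.card)
    (fun l hl => (hlast l hl).1) hne (by rw [nsmul_eq_mul]; exact (mul_div_cancel₀ _ hH.ne').le)
  set F := (walksFrom H R L a).filter (last · = b)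
  have hw : (0 : ℝ) < (walksFrom H R L a).card := by
    exact_mod_cast h.card_walksFrom_pos L ha
  have hFpos : (0 : ℝ) < F.card := (div_pos hw hH).trans_le hcard
  have hFpos' : F.card ≠ 0 := by
    rintro h0
    rw [h0] at hFpos
    simp at hFpos
  have hlogF : c * L - Real.log H.card ≤ Real.log F.card := by
    have := Real.log_le_log (div_pos hw hH) hcard
    rw [Real.log_div hw.ne' hH.ne'] at this
    linarith
  let m := Nat.log 2 F.card
  have hm₁ : 2 ^ m ≤ F.card := Nat.pow_log_le_self 2 hFpos'
  have hm₂ : Real.log F.card < (m + 1) * Real.log 2 := by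
    have h₁ : (F.card : ℝ) < 2 ^ (m + 1) := by
      exact_mod_cast Nat.lt_pow_succ_log_self one_lt_two F.card
    have h₂ := Real.log_lt_log hFpos h₁
    rw [Real.log_pow] at h₂
    exact_mod_cast h₂
  have hmem : ∀ l ∈ F, l.length = L ∧ IsWalk R a l b := by
    intro l hl
    obtain ⟨hl', rfl⟩ := Finset.mem_filter.1 hl
    exact ⟨(h.isWalk_of_mem_walksFrom ha hl').1, (hlast l hl').2⟩
  have hba : IsWalk R b (r a b) a := by
    obtain ⟨l, hl⟩ := Finset.card_pos.1 (Nat.pos_of_ne_zero hFpos')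
    exact hr a b (h.reflTransGen_symm (hmem l hl).2.reflTransGen)
  obtain ⟨φ⟩ : Nonempty ((Fin m → Fin 2) ↪ F) :=
    Function.Embedding.nonempty_of_card_le (by simpa using hm₁)
  refine ⟨L + (r a b).length, m, fun x => (φ x : List α) ++ r a b, ?_, ?_, fun x => ⟨?_, ?_⟩⟩
  · have h₁ : s * ((r a b).length : ℝ) ≤ s * D :=
      mul_le_mul_of_nonneg_left (by exact_mod_cast hD a ha b hb) hs
    push_cast
    nlinarith
  · intro x y hxy
    exact φ.injective (Subtype.ext (List.append_cancel_right hxy))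
  · simp [(hmem _ (φ x).2).1]
  · exact (hmem _ (φ x).2).2.append hba

end IsBalanced

end Counting

/-! ### Amenable sets of vertices of a multigraph -/

namespace OrientedMultigraph

variable {Γ : OrientedMultigraph} {d : ℕ}

theorem tgt_rev (e : Γ.E) : Γ.tgt (Γ.rev e) = Γ.src e := by
  rw [← Γ.src_rev, Γ.rev_rev]

namespace IsRegularOfDegree

theorem finite_src (hreg : Γ.IsRegularOfDegree d) (hd : 0 < d) (v : Γ.V) :
    {e | Γ.src e = v}.Finite :=
  Nat.finite_of_card_ne_zero (α := {e // Γ.src e = v}) (by rw [hreg v]; omega)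

theorem finite_src_mem (hreg : Γ.IsRegularOfDegree d) (hd : 0 < d) (A : Finset Γ.V) :
    {e | Γ.src e ∈ A}.Finite := by
  have : {e | Γ.src e ∈ A} = ⋃ v ∈ A, {e | Γ.src e = v} := by ext; simp
  rw [this]
  exact A.finite_toSet.biUnion fun v _ => hreg.finite_src hd v

theorem finite_edgeBoundary (hreg : Γ.IsRegularOfDegree d) (hd : 0 < d) (A : Finset Γ.V) :
    (Γ.edgeBoundary A).Finite :=
  (hreg.finite_src_mem hd A).subset fun _ he => he.1

end IsRegularOfDegree

/-- The set `U` of vertices contains finite sets that are Følner to any precision. The boundary is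
taken in the whole graph. -/
def IsAmenableSet (Γ : OrientedMultigraph) (U : Set Γ.V) : Prop :=
  ∀ ε : ℝ, 0 < ε → ∃ A : Finset Γ.V, A.Nonempty ∧ ↑A ⊆ U ∧
    ((Γ.edgeBoundary A).ncard : ℝ) ≤ ε * A.card

/-- Adjacency in the subgraph induced on `U`. -/
def AdjIn (Γ : OrientedMultigraph) (U : Set Γ.V) (x y : Γ.V) : Prop :=
  x ∈ U ∧ y ∈ U ∧ ∃ e, Γ.src e = x ∧ Γ.tgt e = y

/-- Any two vertices of `U` are joined by a path in `U`. -/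
def IsConnectedSet (Γ : OrientedMultigraph) (U : Set Γ.V) : Prop :=
  ∀ x ∈ U, ∀ y ∈ U, Relation.ReflTransGen (Γ.AdjIn U) x y

theorem AdjIn.symm {U : Set Γ.V} {x y : Γ.V} (h : Γ.AdjIn U x y) : Γ.AdjIn U y x := by
  obtain ⟨hx, hy, e, rfl, rfl⟩ := h
  exact ⟨hy, hx, Γ.rev e, Γ.src_rev e, tgt_rev e⟩

theorem reflTransGen_adjIn_symm {U : Set Γ.V} {x y : Γ.V}
    (h : Relation.ReflTransGen (Γ.AdjIn U) x y) : Relation.ReflTransGen (Γ.AdjIn U) y x := by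
  induction h with
  | refl => exact .refl
  | tail _ h ih => exact .head h.symm ih

theorem IsAmenable.isAmenableSet_univ [Nonempty Γ.V] (h : Γ.IsAmenable d) (hd : 0 < d) :
    Γ.IsAmenableSet Set.univ := by
  classical
  intro ε hε
  obtain ⟨v⟩ := ‹Nonempty Γ.V›
  have : Nonempty {A : Finset Γ.V // A.Nonempty} := ⟨⟨{v}, by simp⟩⟩
  have hd' : (0 : ℝ) < d := by exact_mod_cast hd
  have hlt : Γ.isoperimetricConstant d < ε / d := by
    rw [show Γ.isoperimetricConstant d = 0 from h]
    positivity
  obtain ⟨⟨A, hA⟩, hlt⟩ := exists_lt_of_ciInf_lt hlt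
  refine ⟨A, hA, Set.subset_univ _, ?_⟩
  have hc : (0 : ℝ) < A.card := by exact_mod_cast hA.card_pos
  have h₁ : ((Γ.edgeBoundary A).ncard : ℝ) / A.card < ε := by
    have h₂ := mul_lt_mul_of_pos_left hlt hd'
    simp only at h₂
    field_simp at h₂
    field_simp
    linarith
  exact ((div_lt_iff₀ hc).1 h₁).le

/-- In an infinite connected graph every nonempty finite set has a boundary. -/
theorem one_le_ncard_edgeBoundary [Infinite Γ.V] (hreg : Γ.IsRegularOfDegree d) (hd : 0 < d)
    (hconn : Γ.IsConnectedSet Set.univ) {A : Finset Γ.V} (hA : A.Nonempty) :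
    1 ≤ (Γ.edgeBoundary A).ncard := by
  by_contra! h
  have h0 : Γ.edgeBoundary A = ∅ :=
    (Set.ncard_eq_zero (hreg.finite_edgeBoundary hd A)).1 (by omega)
  obtain ⟨a, ha⟩ := hA
  obtain ⟨b, hb⟩ := Infinite.exists_notMem_finset A
  refine hb ?_
  have := hconn a trivial b trivial
  induction this with
  | refl => exact ha
  | tail _ h ih =>
    by_contra hc
    obtain ⟨-, -, e, rfl, rfl⟩ := h
    have : e ∈ Γ.edgeBoundary A := ⟨by_contra fun hs => hs (ih hs), hc⟩
    rw [h0] at this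
    exact this

/-- Removing a vertex from the Følner sets, which are large, costs little. -/
theorem IsAmenableSet.diff_singleton [Infinite Γ.V] (hreg : Γ.IsRegularOfDegree d) (hd : 0 < d)
    (hconn : Γ.IsConnectedSet Set.univ) {U : Set Γ.V} (hU : Γ.IsAmenableSet U) (x : Γ.V) :
    Γ.IsAmenableSet (U \ {x}) := by
  classical
  intro ε hε
  have hd' : (0 : ℝ) < d := by exact_mod_cast hd
  have hδ : 0 < ε / (1 + d + ε) := by positivity
  obtain ⟨A, hA, hAU, hbd⟩ := hU _ hδ
  have h₁ : (1 : ℝ) ≤ (Γ.edgeBoundary A).ncard := by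
    exact_mod_cast one_le_ncard_edgeBoundary hreg hd hconn hA
  have h₂ : (1 + d + ε) * (Γ.edgeBoundary A).ncard ≤ ε * A.card := by
    have := mul_le_mul_of_nonneg_left hbd (show 0 ≤ 1 + d + ε by positivity)
    refine this.trans_eq ?_
    field_simp
  have h₃ : (A.card : ℝ) - 1 ≤ (A.erase x).card := by
    have := Finset.pred_card_le_card_erase (s := A) (a := x)
    have : A.card ≤ (A.erase x).card + 1 := by omega
    have : (A.card : ℝ) ≤ (A.erase x).card + 1 := by exact_mod_cast this
    linarith
  have h₄ : (Γ.edgeBoundary (A.erase x)).ncard ≤ (Γ.edgeBoundary A).ncard + d := by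
    have hsub : Γ.edgeBoundary (A.erase x) ⊆ Γ.edgeBoundary A ∪ Γ.rev '' {e | Γ.src e = x} := by
      rintro e ⟨hs, ht⟩
      rw [Finset.mem_erase] at hs ht
      by_cases htx : Γ.tgt e = x
      · exact Or.inr ⟨Γ.rev e, (Γ.src_rev e).trans htx, Γ.rev_rev e⟩
      · exact Or.inl ⟨hs.2, fun hA => ht ⟨htx, hA⟩⟩
    refine (Set.ncard_le_ncard hsub ((hreg.finite_edgeBoundary hd A).union
      ((hreg.finite_src hd x).image _))).trans ((Set.ncard_union_le _ _).trans ?_)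
    gcongr
    exact (Set.ncard_image_le (hreg.finite_src hd x)).trans (hreg x).le
  have h₄' : ((Γ.edgeBoundary (A.erase x)).ncard : ℝ) ≤ (Γ.edgeBoundary A).ncard + d := by
    exact_mod_cast h₄
  have h₅ : ((Γ.edgeBoundary (A.erase x)).ncard : ℝ) ≤ ε * (A.erase x).card := by nlinarith
  refine ⟨A.erase x, ?_, ?_, h₅⟩
  · rw [← Finset.card_pos]
    have : (0 : ℝ) < (A.erase x).card := by nlinarith
    exact_mod_cast this
  · intro y hy
    rw [Finset.mem_coe, Finset.mem_erase] at hy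
    exact ⟨hAU hy.2, hy.1⟩

/-- A smallest set among those with a given isoperimetric ratio. -/
theorem IsAmenableSet.exists_minimal {U : Set Γ.V} (hU : Γ.IsAmenableSet U) {ε : ℝ} (hε : 0 < ε) :
    ∃ A : Finset Γ.V, A.Nonempty ∧ ↑A ⊆ U ∧ ((Γ.edgeBoundary A).ncard : ℝ) ≤ ε * A.card ∧
      ∀ B ⊂ A, B.Nonempty → ε * B.card < (Γ.edgeBoundary B).ncard := by
  classical
  let P : ℕ → Prop := fun n => ∃ A : Finset Γ.V, A.card = n ∧ A.Nonempty ∧ ↑A ⊆ U ∧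
    ((Γ.edgeBoundary A).ncard : ℝ) ≤ ε * A.card
  have hP : ∃ n, P n := by
    obtain ⟨A, hA⟩ := hU ε hε
    exact ⟨_, A, rfl, hA⟩
  obtain ⟨A, hcard, hA, hAU, hbd⟩ := Nat.find_spec hP
  refine ⟨A, hA, hAU, hbd, fun B hB hne => ?_⟩
  by_contra! hle
  refine Nat.find_min hP (m := B.card) ?_ ⟨B, rfl, hne, fun x hx => hAU (hB.1 hx), hle⟩
  rw [← hcard]
  exact Finset.card_lt_card hB

/-- Some connected component of an amenable set with a vertex removed is amenable. -/
theorem exists_amenable_component [Infinite Γ.V] (hreg : Γ.IsRegularOfDegree d) (hd : 0 < d)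
    (hconn : Γ.IsConnectedSet Set.univ) {U : Set Γ.V} (hU : Γ.IsAmenableSet U)
    (hUc : Γ.IsConnectedSet U) (x : Γ.V) :
    ∃ U' ⊆ U \ {x}, Γ.IsAmenableSet U' ∧ Γ.IsConnectedSet U' := by
  classical
  by_cases hx : x ∈ U
  swap
  · exact ⟨U, fun y hy => ⟨hy, fun h : y = x => hx (h ▸ hy)⟩, hU, hUc⟩
  set W := U \ {x}
  have hWA : Γ.IsAmenableSet W := hU.diff_singleton hreg hd hconn x
  let C : Γ.V → Set Γ.V := fun y => {z | z ∈ W ∧ Relation.ReflTransGen (Γ.AdjIn W) y z}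
  have hCc : ∀ y, Γ.IsConnectedSet (C y) := by
    -- Paths in `W` between points of a component stay in it.
    have h : ∀ y, ∀ a ∈ C y, ∀ b, Relation.ReflTransGen (Γ.AdjIn W) a b →
        Relation.ReflTransGen (Γ.AdjIn (C y)) a b ∧ b ∈ C y := by
      intro y a ha b hab
      induction hab with
      | refl => exact ⟨.refl, ha⟩
      | tail _ hbc ih =>
        have hc : _ ∈ C y := ⟨hbc.2.1, ih.2.2.tail hbc⟩
        exact ⟨ih.1.tail ⟨ih.2, hc, hbc.2.2⟩, hc⟩
    intro y a ha b hb
    exact (h y a ha b ((reflTransGen_adjIn_symm ha.2).trans hb.2)).1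
  -- Every component is adjacent to `x`, so there are only finitely many of them.
  have hCx : ∀ y ∈ W, ∃ e, Γ.src e = x ∧ y ∈ C (Γ.tgt e) := by
    intro y hy
    have hpath := hUc x hx y hy.1
    induction hpath with
    | refl => exact absurd rfl hy.2
    | @tail b c _ hbc ih =>
      by_cases hbx : b = x
      · obtain ⟨-, -, e, hs, rfl⟩ := hbc
        exact ⟨e, hs.trans hbx, hy, .refl⟩
      · have hb : b ∈ W := ⟨hbc.1, hbx⟩
        obtain ⟨e, he, hbC⟩ := ih hb
        exact ⟨e, he, hy, hbC.2.tail ⟨hb, hy, hbc.2.2⟩⟩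
  suffices ∃ e, Γ.src e = x ∧ Γ.IsAmenableSet (C (Γ.tgt e)) by
    obtain ⟨e, -, he⟩ := this
    exact ⟨C (Γ.tgt e), fun z hz => hz.1, he, hCc _⟩
  by_contra! hno
  -- A common isoperimetric bound for the finitely many components.
  have hno' : ∀ e : Γ.E, ∃ ε : ℝ, 0 < ε ∧ (Γ.src e = x → ∀ A : Finset Γ.V, A.Nonempty →
      ↑A ⊆ C (Γ.tgt e) → ε * A.card < (Γ.edgeBoundary A).ncard) := by
    intro e
    by_cases he : Γ.src e = x
    · have := hno e he
      simp only [IsAmenableSet, not_forall, not_exists, not_and, not_le] at this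
      obtain ⟨ε, hε, h⟩ := this
      exact ⟨ε, hε, fun _ => h⟩
    · exact ⟨1, one_pos, fun h => absurd h he⟩
  choose ε hε hA using hno'
  obtain ⟨δ, hδ, hδle⟩ : ∃ δ : ℝ, 0 < δ ∧ ∀ e, Γ.src e = x → δ ≤ ε e := by
    rcases {e | Γ.src e = x}.eq_empty_or_nonempty with h0 | hne
    · exact ⟨1, one_pos, fun e he => absurd he (Set.eq_empty_iff_forall_notMem.1 h0 e)⟩
    · obtain ⟨e, -, he⟩ := Set.exists_min_image _ ε (hreg.finite_src hd x) hne
      exact ⟨ε e, hε e, he⟩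
  obtain ⟨A, hne, hAW, hbd, hmin⟩ := hWA.exists_minimal hδ
  obtain ⟨y, hy⟩ := hne
  obtain ⟨e, he, hye⟩ := hCx y (hAW hy)
  set A₁ := A.filter (· ∈ C (Γ.tgt e))
  set A₂ := A.filter (· ∉ C (Γ.tgt e))
  have hA₁ne : A₁.Nonempty := ⟨y, Finset.mem_filter.2 ⟨hy, hye⟩⟩
  have hA₁lt : δ * A₁.card < (Γ.edgeBoundary A₁).ncard := by
    refine lt_of_le_of_lt ?_ (hA e he A₁ hA₁ne fun z hz => (Finset.mem_filter.1 hz).2)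
    exact mul_le_mul_of_nonneg_right (hδle e he) (Nat.cast_nonneg _)
  have hA₂le : δ * A₂.card ≤ (Γ.edgeBoundary A₂).ncard := by
    rcases A₂.eq_empty_or_nonempty with h0 | hne
    · simp [h0]
    · refine (hmin A₂ ?_ hne).le
      rw [Finset.filter_ssubset]
      exact ⟨y, hy, fun h => h hye⟩
  have hcard : (A₁.card : ℝ) + A₂.card = A.card := by
    exact_mod_cast Finset.card_filter_add_card_filter_not (s := A) (p := (· ∈ C (Γ.tgt e)))
  have hstep : ∀ g, Γ.src g ∈ W → Γ.tgt g ∈ W →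
      (Γ.src g ∈ C (Γ.tgt e) ↔ Γ.tgt g ∈ C (Γ.tgt e)) := by
    intro g hs ht
    have hadj : Γ.AdjIn W (Γ.src g) (Γ.tgt g) := ⟨hs, ht, g, rfl, rfl⟩
    exact ⟨fun h => ⟨ht, h.2.tail hadj⟩, fun h => ⟨hs, h.2.tail hadj.symm⟩⟩
  have hbdle : (Γ.edgeBoundary A₁).ncard + (Γ.edgeBoundary A₂).ncard ≤
      (Γ.edgeBoundary A).ncard := by
    rw [← Set.ncard_union_eq _ (hreg.finite_edgeBoundary hd _) (hreg.finite_edgeBoundary hd _)]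
    · refine Set.ncard_le_ncard ?_ (hreg.finite_edgeBoundary hd A)
      rintro g (⟨hs, ht⟩ | ⟨hs, ht⟩) <;>
      · rw [Finset.mem_filter] at hs ht
        refine ⟨hs.1, fun htA => ht ⟨htA, ?_⟩⟩
        have := hstep g (hAW hs.1) (hAW htA)
        tauto
    · rw [Set.disjoint_left]
      intro g h₁ h₂
      exact (Finset.mem_filter.1 h₂.1).2 (Finset.mem_filter.1 h₁.1).2
  have hbdle' : ((Γ.edgeBoundary A₁).ncard : ℝ) + (Γ.edgeBoundary A₂).ncard ≤
      (Γ.edgeBoundary A).ncard := by exact_mod_cast hbdle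
  nlinarith

theorem exists_amenable_connected_diff [Infinite Γ.V] (hreg : Γ.IsRegularOfDegree d) (hd : 0 < d)
    (hconn : Γ.IsConnectedSet Set.univ) {U : Set Γ.V} (hU : Γ.IsAmenableSet U)
    (hUc : Γ.IsConnectedSet U) {F : Set Γ.V} (hF : F.Finite) :
    ∃ U' ⊆ U \ F, Γ.IsAmenableSet U' ∧ Γ.IsConnectedSet U' := by
  induction F, hF using Set.Finite.induction_on with
  | empty => exact ⟨U, by simp, hU, hUc⟩
  | @insert x F _ _ ih =>
    obtain ⟨U₁, h₁, h₂, h₃⟩ := ih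
    obtain ⟨U₂, h₄, h₅, h₆⟩ := exists_amenable_component hreg hd hconn h₂ h₃ x
    refine ⟨U₂, fun y hy => ⟨(h₁ (h₄ hy).1).1, ?_⟩, h₅, h₆⟩
    rintro (h | h)
    · exact (h₄ hy).2 h
    · exact (h₁ (h₄ hy).1).2 h

/-- Amenability persists towards one end: along an exhaustion `F` of the graph by finite sets there
are nested connected amenable sets that avoid the members of the exhaustion. -/
theorem exists_amenable_end [Infinite Γ.V] (hreg : Γ.IsRegularOfDegree d) (hd : 0 < d)
    (hconn : Γ.IsConnectedSet Set.univ) (hU : Γ.IsAmenableSet Set.univ) (F : ℕ → Set Γ.V)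
    (hF : ∀ n, (F n).Finite) :
    ∃ U : ℕ → Set Γ.V, U 0 = Set.univ ∧ Antitone U ∧ (∀ n, Γ.IsAmenableSet (U n)) ∧
      (∀ n, Γ.IsConnectedSet (U n)) ∧ ∀ n, Disjoint (U (n + 1)) (F n) := by
  have hstep : ∀ (S : {U : Set Γ.V // Γ.IsAmenableSet U ∧ Γ.IsConnectedSet U}) (n : ℕ),
      ∃ S' : {U : Set Γ.V // Γ.IsAmenableSet U ∧ Γ.IsConnectedSet U}, S'.1 ⊆ S.1 \ F n := by
    intro S n
    obtain ⟨U', h₁, h₂⟩ := exists_amenable_connected_diff hreg hd hconn S.2.1 S.2.2 (hF n)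
    exact ⟨⟨U', h₂⟩, h₁⟩
  choose next hnext using hstep
  let S : ℕ → {U : Set Γ.V // Γ.IsAmenableSet U ∧ Γ.IsConnectedSet U} := fun n =>
    Nat.rec ⟨Set.univ, hU, hconn⟩ (fun n S => next S n) n
  refine ⟨fun n => (S n).1, rfl, antitone_nat_of_succ_le fun n => ?_, fun n => (S n).2.1,
    fun n => (S n).2.2, fun n => ?_⟩
  · exact (hnext (S n) n).trans Set.sdiff_subset
  · exact Set.disjoint_left.2 fun y hy => (hnext (S n) n hy).2

end OrientedMultigraph

/-! ### Non-backtracking walks in amenable sets -/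

namespace OrientedMultigraph

variable {Γ : OrientedMultigraph} {d : ℕ}

/-- The oriented edge `f` may follow `e` in a non-backtracking walk through vertices of `U`. -/
def NBStep (Γ : OrientedMultigraph) (U : Set Γ.V) (e f : Γ.E) : Prop :=
  Γ.src e ∈ U ∧ Γ.tgt e ∈ U ∧ Γ.tgt f ∈ U ∧ Γ.src f = Γ.tgt e ∧ f ≠ Γ.rev e

/-- A non-backtracking walk in `U` can return along `e` in either direction after having traversed
`e` in the other one. -/
def IsReversible (Γ : OrientedMultigraph) (U : Set Γ.V) (e : Γ.E) : Prop :=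
  Relation.ReflTransGen (Γ.NBStep U) e (Γ.rev e) ∧ Relation.ReflTransGen (Γ.NBStep U) (Γ.rev e) e

theorem NBStep.mono {U U' : Set Γ.V} (h : U ⊆ U') (e f : Γ.E) (hs : Γ.NBStep U e f) :
    Γ.NBStep U' e f :=
  ⟨h hs.1, h hs.2.1, h hs.2.2.1, hs.2.2.2⟩

theorem NBStep.rev {U : Set Γ.V} {e f : Γ.E} (h : Γ.NBStep U e f) :
    Γ.NBStep U (Γ.rev f) (Γ.rev e) := by
  obtain ⟨h₁, h₂, h₃, h₄, h₅⟩ := h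
  refine ⟨?_, ?_, ?_, ?_, ?_⟩
  · rwa [Γ.src_rev]
  · rwa [tgt_rev, h₄]
  · rwa [tgt_rev]
  · rw [Γ.src_rev, tgt_rev, h₄]
  · rw [Γ.rev_rev]
    exact h₅.symm

theorem reflTransGen_nbStep_rev {U : Set Γ.V} {e f : Γ.E}
    (h : Relation.ReflTransGen (Γ.NBStep U) e f) :
    Relation.ReflTransGen (Γ.NBStep U) (Γ.rev f) (Γ.rev e) := by
  induction h with
  | refl => exact .refl
  | tail _ h ih => exact .head h.rev ih

namespace IsReversible

variable {U : Set Γ.V} {e : Γ.E}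

theorem rev (h : Γ.IsReversible U e) : Γ.IsReversible U (Γ.rev e) := by
  rw [IsReversible, Γ.rev_rev]
  exact ⟨h.2, h.1⟩

theorem mono {U' : Set Γ.V} (h : Γ.IsReversible U e) (hU : U ⊆ U') : Γ.IsReversible U' e :=
  ⟨Relation.ReflTransGen.mono (NBStep.mono hU) _ _ h.1,
    Relation.ReflTransGen.mono (NBStep.mono hU) _ _ h.2⟩

/-- From a reversible edge non-backtracking walks reach all vertices. -/
theorem exists_reach_vertex (h : Γ.IsReversible U e) (hU : Γ.IsConnectedSet U)
    (hs : Γ.src e ∈ U) (ht : Γ.tgt e ∈ U) {x : Γ.V} (hx : x ∈ U) :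
    ∃ f, Relation.ReflTransGen (Γ.NBStep U) e f ∧ Γ.src f ∈ U ∧ Γ.tgt f = x := by
  have hpath := hU _ ht _ hx
  clear hx
  induction hpath with
  | refl => exact ⟨e, .refl, hs, rfl⟩
  | @tail x y _ hxy ih =>
    obtain ⟨f, hf, hsf, htf⟩ := ih
    obtain ⟨hx, hy, g, rfl, rfl⟩ := hxy
    by_cases hg : g = Γ.rev f
    · subst hg
      rw [tgt_rev]
      rcases hf.cases_tail with rfl | ⟨f', hf', hstep⟩
      · exact ⟨Γ.rev f, h.1, by rwa [Γ.src_rev], tgt_rev f⟩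
      · exact ⟨f', hf', hstep.1, hstep.2.2.2.1.symm⟩
    · exact ⟨g, hf.tail ⟨hsf, htf ▸ hx, hy, htf.symm, hg⟩, hx, rfl⟩

/-- Between reversible edges there are non-backtracking walks. -/
theorem reach {U' : Set Γ.V} {f : Γ.E} (h : Γ.IsReversible U e) (hU : Γ.IsConnectedSet U)
    (hs : Γ.src e ∈ U) (ht : Γ.tgt e ∈ U) (hf : Γ.IsReversible U' f) (hU' : U' ⊆ U)
    (hsf : Γ.src f ∈ U) (htf : Γ.tgt f ∈ U) : Relation.ReflTransGen (Γ.NBStep U) e f := by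
  obtain ⟨g, hg, hsg, htg⟩ := h.exists_reach_vertex hU hs ht hsf
  by_cases hfg : f = Γ.rev g
  · subst hfg
    have := (hf.mono hU').2
    rw [Γ.rev_rev] at this
    exact hg.trans this
  · exact hg.tail ⟨hsg, htg ▸ hsf, htf, htg.symm, hfg⟩

end IsReversible

section Core

/-- The edges of the subgraph induced on `A` that start at `x`. -/
def inducedStar (Γ : OrientedMultigraph) (A : Finset Γ.V) (x : Γ.V) : Set Γ.E :=
  {e | Γ.src e = x ∧ Γ.tgt e ∈ A}

theorem ncard_inducedStar_add (hreg : Γ.IsRegularOfDegree d) (hd : 0 < d) (A : Finset Γ.V)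
    (x : Γ.V) : (Γ.inducedStar A x).ncard + {e | Γ.src e = x ∧ Γ.tgt e ∉ A}.ncard = d := by
  have hfin := hreg.finite_src hd x
  rw [← Set.ncard_union_eq _ (hfin.subset fun e he => he.1) (hfin.subset fun e he => he.1)]
  · rw [← hreg x, ← _root_.Nat.card_coe_set_eq]
    congr
    ext e
    simp only [inducedStar, Set.mem_union, Set.mem_ofPred_eq]
    tauto
  · rw [Set.disjoint_left]
    exact fun e h₁ h₂ => h₂.2 h₁.2

/-- A smallest set with small isoperimetric ratio induces a subgraph of minimal degree at least
two. -/
theorem two_le_ncard_inducedStar (hreg : Γ.IsRegularOfDegree d) (hd : 3 ≤ d) {A : Finset Γ.V}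
    {ε : ℝ} (hε : ε ≤ 1) (hbd : ((Γ.edgeBoundary A).ncard : ℝ) ≤ ε * A.card)
    (hmin : ∀ B ⊂ A, B.Nonempty → ε * B.card < (Γ.edgeBoundary B).ncard) {x : Γ.V} (hx : x ∈ A) :
    2 ≤ (Γ.inducedStar A x).ncard := by
  classical
  by_contra! hlt
  have hd0 : 0 < d := by omega
  have hstar := ncard_inducedStar_add hreg hd0 A x
  set O := {e | Γ.src e = x ∧ Γ.tgt e ∉ A}
  have hfin := hreg.finite_src hd0 x
  have hfO : O.Finite := hfin.subset fun e he => he.1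
  have hfS : (Γ.inducedStar A x).Finite := hfin.subset fun e he => he.1
  have hOsub : O ⊆ Γ.edgeBoundary A := fun e he => ⟨he.1 ▸ hx, he.2⟩
  have hfA := hreg.finite_edgeBoundary hd0 A
  have hsub : Γ.edgeBoundary (A.erase x) ⊆ (Γ.edgeBoundary A \ O) ∪ Γ.rev '' Γ.inducedStar A x := by
    rintro e ⟨hs, ht⟩
    rw [Finset.mem_erase] at hs ht
    by_cases htx : Γ.tgt e = x
    · exact Or.inr ⟨Γ.rev e, ⟨(Γ.src_rev e).trans htx, (tgt_rev e).symm ▸ hs.2⟩, Γ.rev_rev e⟩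
    · exact Or.inl ⟨⟨hs.2, fun hA => ht ⟨htx, hA⟩⟩, fun he => hs.1 he.1⟩
  have h₁ : (Γ.edgeBoundary (A.erase x)).ncard ≤ (Γ.edgeBoundary A \ O).ncard + 1 := by
    refine (Set.ncard_le_ncard hsub (hfA.sdiff.union (hfS.image _))).trans
      ((Set.ncard_union_le _ _).trans ?_)
    gcongr
    exact (Set.ncard_image_le hfS).trans (by omega)
  have h₂ := Set.ncard_sdiff_add_ncard_of_subset hOsub hfA
  have h₃ : (A.erase x).card + 1 = A.card := Finset.card_erase_add_one hx
  have h₄ : (Γ.edgeBoundary (A.erase x)).ncard + 1 ≤ (Γ.edgeBoundary A).ncard := by omega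
  have h₃' : ((A.erase x).card : ℝ) + 1 = A.card := by exact_mod_cast h₃
  have h₄' : ((Γ.edgeBoundary (A.erase x)).ncard : ℝ) + 1 ≤ (Γ.edgeBoundary A).ncard := by
    exact_mod_cast h₄
  rcases (A.erase x).eq_empty_or_nonempty with h0 | hne
  · rw [h0, Finset.card_empty, Nat.cast_zero, zero_add] at h₃'
    have h₅ : (2 : ℝ) ≤ (Γ.edgeBoundary A).ncard := by
      exact_mod_cast (show 2 ≤ (Γ.edgeBoundary A).ncard by omega)
    rw [← h₃'] at hbd
    linarith
  · have := hmin _ (Finset.erase_ssubset hx) hne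
    nlinarith

/-- The non-backtracking steps in a finite induced subgraph of minimal degree at least two are
balanced: `e` has `deg (tgt e) - 1` successors and `deg (src e) - 1` predecessors. -/
theorem exists_isBalanced_nbStep (hreg : Γ.IsRegularOfDegree d) (hd : 0 < d) {A : Finset Γ.V}
    (hA : ∀ x ∈ A, 2 ≤ (Γ.inducedStar A x).ncard) :
    ∃ H : Finset Γ.E, (∀ e, e ∈ H ↔ Γ.src e ∈ A ∧ Γ.tgt e ∈ A) ∧
      (∀ e ∈ H, (successors H (Γ.NBStep A) e).card + 1 = (Γ.inducedStar A (Γ.tgt e)).ncard) ∧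
      IsBalanced H (Γ.NBStep A) := by
  classical
  have hfin : {e | Γ.src e ∈ A ∧ Γ.tgt e ∈ A}.Finite :=
    (hreg.finite_src_mem hd A).subset fun e he => he.1
  have hmem : ∀ e, e ∈ hfin.toFinset ↔ Γ.src e ∈ A ∧ Γ.tgt e ∈ A := by simp
  set H := hfin.toFinset
  have hfS : ∀ x, (Γ.inducedStar A x).Finite := fun x =>
    (hreg.finite_src hd x).subset fun e he => he.1
  have hsucc : ∀ e ∈ H,
      (successors H (Γ.NBStep A) e).card + 1 = (Γ.inducedStar A (Γ.tgt e)).ncard := by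
    intro e he
    rw [hmem] at he
    have hrev : Γ.rev e ∈ Γ.inducedStar A (Γ.tgt e) := ⟨Γ.src_rev e, (tgt_rev e).symm ▸ he.1⟩
    rw [← Set.ncard_sdiff_singleton_add_one hrev (hfS _), ← Set.ncard_coe_finset]
    congr 2
    ext f
    simp only [successors, Finset.coe_filter, hmem, NBStep, inducedStar, Set.mem_ofPred_eq,
      Set.mem_sdiff, Set.mem_singleton_iff, Finset.mem_coe]
    constructor
    · rintro ⟨-, -, -, h₁, h₂, h₃⟩
      exact ⟨⟨h₂, h₁⟩, h₃⟩
    · rintro ⟨⟨h₁, h₂⟩, h₃⟩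
      exact ⟨⟨h₁ ▸ he.2, h₂⟩, he.1, he.2, h₂, h₁, h₃⟩
  have hrevH : ∀ e, Γ.rev e ∈ H ↔ e ∈ H := by
    intro e
    rw [hmem, hmem, Γ.src_rev, tgt_rev, and_comm]
  have hpred : ∀ e, (predecessors H (Γ.NBStep A) e).card =
      (successors H (Γ.NBStep A) (Γ.rev e)).card := by
    intro e
    refine Finset.card_bij' (fun f _ => Γ.rev f) (fun f _ => Γ.rev f) ?_ ?_
      (fun f _ => Γ.rev_rev f) (fun f _ => Γ.rev_rev f)
    · intro f hf
      rw [predecessors, Finset.mem_filter] at hf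
      rw [successors, Finset.mem_filter, hrevH]
      exact ⟨hf.1, hf.2.rev⟩
    · intro f hf
      rw [successors, Finset.mem_filter] at hf
      rw [predecessors, Finset.mem_filter, hrevH]
      refine ⟨hf.1, ?_⟩
      have := hf.2.rev
      rwa [Γ.rev_rev] at this
  have hpos : ∀ e ∈ H, 0 < (successors H (Γ.NBStep A) e).card := by
    intro e he
    have h₁ := hsucc e he
    have h₂ := hA (Γ.tgt e) ((hmem e).1 he).2
    omega
  have hl : ∀ {e f}, Γ.NBStep A e f → e ∈ H := fun h => (hmem _).2 ⟨h.1, h.2.1⟩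
  have hr : ∀ {e f}, Γ.NBStep A e f → f ∈ H := fun h =>
    (hmem _).2 ⟨h.2.2.2.1.symm ▸ h.2.1, h.2.2.1⟩
  refine ⟨H, hmem, hsucc, ⟨hl, hr, ?_, ?_, ?_⟩⟩
  · intro e he
    obtain ⟨f, hf⟩ := Finset.card_pos.1 (hpos e he)
    exact ⟨f, (Finset.mem_filter.1 hf).2⟩
  · intro e he
    have := hpos _ ((hrevH e).2 he)
    rw [← hpred] at this
    obtain ⟨f, hf⟩ := Finset.card_pos.1 this
    exact ⟨f, (Finset.mem_filter.1 hf).2⟩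
  · intro e f hef
    have h₁ := hsucc e (hl hef)
    have h₂ := hsucc (Γ.rev f) ((hrevH f).2 (hr hef))
    rw [tgt_rev, hef.2.2.2.1] at h₂
    rw [hpred]
    omega

/-- In a Følner set almost all oriented edges lead to vertices of full degree. -/
theorem card_filter_inducedStar_ne_le (hreg : Γ.IsRegularOfDegree d) (hd : 0 < d)
    {A : Finset Γ.V} {H : Finset Γ.E} (hH : ∀ e, e ∈ H ↔ Γ.src e ∈ A ∧ Γ.tgt e ∈ A) :
    {e | e ∈ H ∧ (Γ.inducedStar A (Γ.tgt e)).ncard ≠ d}.ncard ≤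
      d * (Γ.edgeBoundary A).ncard := by
  classical
  have hfin := hreg.finite_edgeBoundary hd A
  set P := hfin.toFinset with hP
  have hsub : {e | e ∈ H ∧ (Γ.inducedStar A (Γ.tgt e)).ncard ≠ d} ⊆
      ⋃ g ∈ P, Γ.rev '' {e | Γ.src e = Γ.src g} := by
    rintro e ⟨he, hne⟩
    have hstar := ncard_inducedStar_add hreg hd A (Γ.tgt e)
    obtain ⟨g, hg⟩ : {g | Γ.src g = Γ.tgt e ∧ Γ.tgt g ∉ A}.Nonempty := by
      by_contra! h0
      rw [h0, Set.ncard_empty] at hstar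
      exact hne hstar
    simp only [Set.mem_iUnion]
    refine ⟨g, ?_, Γ.rev e, (Γ.src_rev e).trans hg.1.symm, Γ.rev_rev e⟩
    rw [hP, Set.Finite.mem_toFinset]
    exact ⟨hg.1.symm ▸ ((hH e).1 he).2, hg.2⟩
  refine (Set.ncard_le_ncard hsub (P.finite_toSet.biUnion fun g _ =>
    (hreg.finite_src hd _).image _)).trans ?_
  refine (Finset.set_ncard_biUnion_le P _).trans ?_
  rw [Set.ncard_eq_toFinset_card _ hfin, mul_comm, ← smul_eq_mul]
  refine Finset.sum_le_card_nsmul _ _ _ fun g _ => ?_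
  exact (Set.ncard_image_le (hreg.finite_src hd _)).trans (hreg _).le

/-- An amenable set carries closed non-backtracking walks of almost maximal entropy through some
reversible edge. -/
theorem IsAmenableSet.exists_closed_walks (hreg : Γ.IsRegularOfDegree d) (hd : 3 ≤ d)
    {U : Set Γ.V} (hU : Γ.IsAmenableSet U) {s : ℝ} (hs : 0 ≤ s) (hsd : s < Real.log (d - 1)) :
    ∃ e, Γ.src e ∈ U ∧ Γ.tgt e ∈ U ∧ Γ.IsReversible U e ∧
      ∃ (L m : ℕ) (B : (Fin m → Fin 2) → List Γ.E), s * L < m * Real.log 2 ∧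
        Function.Injective B ∧ ∀ x, (B x).length = L ∧ IsWalk (Γ.NBStep U) e (B x) e := by
  classical
  have hd0 : 0 < d := by omega
  have hd3 : (3 : ℝ) ≤ d := by exact_mod_cast hd
  have hlog : 0 < Real.log (d - 1) := Real.log_pos (by linarith)
  -- The ratio is so small that the mean of `log (deg - 1)` over the edges exceeds `s`.
  obtain ⟨ε, hε, hε1, hεs⟩ : ∃ ε : ℝ, 0 < ε ∧ ε ≤ 1 ∧ s < Real.log (d - 1) * (1 - d * ε) := by
    refine ⟨min 1 ((1 - s / Real.log (d - 1)) / (2 * d)), ?_, min_le_left _ _, ?_⟩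
    · refine lt_min one_pos (div_pos ?_ (by positivity))
      rw [sub_pos, div_lt_one hlog]
      exact hsd
    · have h₁ : d * min 1 ((1 - s / Real.log (d - 1)) / (2 * d)) ≤
          (1 - s / Real.log (d - 1)) / 2 := by
        refine (mul_le_mul_of_nonneg_left (min_le_right _ _) (Nat.cast_nonneg d)).trans_eq ?_
        field_simp
      have h₂ : 1 - (1 - s / Real.log (d - 1)) / 2 ≤
          1 - d * min 1 ((1 - s / Real.log (d - 1)) / (2 * d)) := by linarith
      refine lt_of_lt_of_le ?_ (mul_le_mul_of_nonneg_left h₂ hlog.le)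
      have h₃ : Real.log (d - 1) * (1 - (1 - s / Real.log (d - 1)) / 2) =
          (Real.log (d - 1) + s) / 2 := by
        field_simp
        ring
      rw [h₃]
      linarith
  obtain ⟨A, hne, hAU, hbd, hmin⟩ := hU.exists_minimal hε
  have hdeg : ∀ x ∈ A, 2 ≤ (Γ.inducedStar A x).ncard := fun x hx =>
    two_le_ncard_inducedStar hreg hd hε1 hbd hmin hx
  obtain ⟨H, hmem, hsucc, hbal⟩ := exists_isBalanced_nbStep hreg hd0 hdeg
  -- Each vertex of `A` is the origin of an edge in `H`.
  have hAH : A.card ≤ H.card := by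
    have hsub : A ⊆ H.image Γ.src := by
      intro x hx
      obtain ⟨e, he⟩ : (Γ.inducedStar A x).Nonempty := by
        by_contra! h0
        have := hdeg x hx
        rw [h0, Set.ncard_empty] at this
        omega
      exact Finset.mem_image.2 ⟨e, (hmem e).2 ⟨he.1.symm ▸ hx, he.2⟩, he.1⟩
    exact (Finset.card_le_card hsub).trans Finset.card_image_le
  have hAH' : (A.card : ℝ) ≤ H.card := by exact_mod_cast hAH
  have hHne : H.Nonempty := Finset.card_pos.1 (hne.card_pos.trans_le hAH)
  have hmean : Real.log (d - 1) * (1 - d * ε) * H.card ≤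
      ∑ e ∈ H, Real.log (successors H (Γ.NBStep A) e).card := by
    have hbad := card_filter_inducedStar_ne_le hreg hd0 hmem
    set P := H.filter fun e => (Γ.inducedStar A (Γ.tgt e)).ncard = d
    set Q := H.filter fun e => ¬ (Γ.inducedStar A (Γ.tgt e)).ncard = d with hQ
    have hQ' : {e | e ∈ H ∧ (Γ.inducedStar A (Γ.tgt e)).ncard ≠ d} = ↑Q := by
      ext e
      simp [hQ]
    rw [hQ', Set.ncard_coe_finset] at hbad
    have hcard : P.card + Q.card = H.card := Finset.card_filter_add_card_filter_not _
    have hcard' : (P.card : ℝ) + Q.card = H.card := by exact_mod_cast hcard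
    have hbad' : (Q.card : ℝ) ≤ d * (Γ.edgeBoundary A).ncard := by exact_mod_cast hbad
    have h₁ : (1 - d * ε) * H.card ≤ P.card := by
      have h₂ : (d : ℝ) * (Γ.edgeBoundary A).ncard ≤ d * (ε * H.card) :=
        mul_le_mul_of_nonneg_left (hbd.trans (mul_le_mul_of_nonneg_left hAH' hε.le))
          (Nat.cast_nonneg d)
      linarith
    calc Real.log (d - 1) * (1 - d * ε) * H.card
        ≤ P.card * Real.log (d - 1) := by nlinarith
      _ = ∑ e ∈ P, Real.log (successors H (Γ.NBStep A) e).card := by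
          rw [← nsmul_eq_mul, ← Finset.sum_const]
          refine Finset.sum_congr rfl fun e he => ?_
          obtain ⟨heH, he⟩ := Finset.mem_filter.1 he
          have := hsucc e heH
          rw [he] at this
          rw [← this]
          push_cast
          ring_nf
      _ ≤ ∑ e ∈ H, Real.log (successors H (Γ.NBStep A) e).card :=
          Finset.sum_le_sum_of_subset_of_nonneg (Finset.filter_subset _ _)
            fun e _ _ => Real.log_natCast_nonneg _
  obtain ⟨e, heH, ⟨f, hef, hf⟩, L, m, B, hLm, hB, hBw⟩ :=
    hbal.exists_closed_walks hHne hs hεs hmean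
  -- A branching edge `f` has two successors `g₁`, `g₂`; the walk may return to `f` after `g₁` and,
  -- as `rev g₂` has the successor `g₁`, it may also return to `rev g₂`.
  obtain ⟨g₁, hg₁, g₂, hg₂, hg⟩ := Finset.one_lt_card.1 hf
  rw [hbal.mem_successors] at hg₁ hg₂
  have hrev : Relation.ReflTransGen (Γ.NBStep A) e (Γ.rev e) := by
    have hstep : Γ.NBStep A (Γ.rev g₂) g₁ := by
      refine ⟨?_, ?_, hg₁.2.2.1, ?_, ?_⟩
      · rw [Γ.src_rev]
        exact hg₂.2.2.1
      · rw [tgt_rev, hg₂.2.2.2.1]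
        exact hg₂.2.1
      · rw [tgt_rev, hg₁.2.2.2.1, hg₂.2.2.2.1]
      · rwa [Γ.rev_rev]
    exact (hef.tail hg₁).trans ((hbal.reflTransGen_of_rel hstep).trans
      (reflTransGen_nbStep_rev (hef.tail hg₂)))
  exact ⟨e, hAU ((hmem e).1 heH).1, hAU ((hmem e).1 heH).2,
    IsReversible.mono ⟨hrev, hbal.reflTransGen_symm hrev⟩ hAU, L, m, B, hLm, hB,
    fun x => ⟨(hBw x).1, (hBw x).2.mono (NBStep.mono hAU)⟩⟩

end Core

end OrientedMultigraph

/-! ### Geodesics in a regular tree and the dimension of its boundary -/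

section Tree

open SimpleGraph

variable {V : Type*} {X : SimpleGraph V}

/-- In a tree only one neighbour of a vertex is closer to `o`. -/
theorem SimpleGraph.IsTree.eq_of_adj_of_dist_eq (hX : X.IsTree) {o u v w : V} (huv : X.Adj u v)
    (hwv : X.Adj w v) (hu : X.dist o v = X.dist o u + 1) (hw : X.dist o v = X.dist o w + 1) :
    u = w := by
  obtain ⟨p, hp⟩ := hX.connected.exists_walk_length_eq_dist o u
  obtain ⟨q, hq⟩ := hX.connected.exists_walk_length_eq_dist o w
  have hp' : (p.concat huv).IsPath :=
    Walk.isPath_of_length_eq_dist _ (by rw [Walk.length_concat, hp, hu])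
  have hq' : (q.concat hwv).IsPath :=
    Walk.isPath_of_length_eq_dist _ (by rw [Walk.length_concat, hq, hw])
  have h := congrArg Walk.penultimate ((hX.existsUnique_path o v).unique hp' hq')
  simpa using h

theorem SimpleGraph.IsTree.dist_eq_add_one_of_adj_of_ne (hX : X.IsTree) {o u v w : V}
    (huv : X.Adj u v) (hvw : X.Adj v w) (hne : w ≠ u) (h : X.dist o v = X.dist o u + 1) :
    X.dist o w = X.dist o v + 1 := by
  rcases hX.dist_eq_dist_add_one_of_adj o hvw with h' | h'
  · exact absurd (hX.eq_of_adj_of_dist_eq huv hvw.symm h h').symm hne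
  · exact h'

/-- Non-backtracking paths in a tree are geodesics. -/
theorem SimpleGraph.IsTree.dist_of_nonbacktracking (hX : X.IsTree) {v : ℕ → V} {N : ℕ}
    (hadj : ∀ i < N, X.Adj (v i) (v (i + 1))) (hne : ∀ i, i + 1 < N → v (i + 2) ≠ v i) (m k : ℕ)
    (hN : m + k ≤ N) : X.dist (v m) (v (m + k)) = k := by
  induction k using Nat.twoStepInduction with
  | zero => simp
  | one => exact dist_eq_one_iff_adj.2 (hadj m (by omega))
  | more k ih₁ ih₂ =>
    have h₁ := ih₁ (by omega)
    have h₂ := ih₂ (by omega)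
    have := hX.dist_eq_add_one_of_adj_of_ne (o := v m) (hadj (m + k) (by omega))
      (hadj (m + k + 1) (by omega)) (hne (m + k) (by omega)) (by rw [h₁]; exact h₂)
    rw [show m + (k + 2) = m + k + 1 + 1 by ring, this]
    rw [show m + (k + 1) = m + k + 1 by ring] at h₂
    omega

theorem SimpleGraph.Connected.exists_adj_dist_eq (hX : X.Connected) {o x : V} {n : ℕ}
    (h : X.dist o x = n + 1) : ∃ v, X.Adj v x ∧ X.dist o v = n := by
  obtain ⟨p, hp⟩ := hX.exists_walk_length_eq_dist o x
  have hnil : ¬ p.Nil := by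
    intro hn
    rw [← Walk.length_eq_zero_iff] at hn
    omega
  refine ⟨p.penultimate, p.adj_penultimate hnil, ?_⟩
  have h₁ := X.dist_le p.dropLast
  have h₂ : p.dropLast.length + 1 = p.length := by
    rw [Walk.length_dropLast]
    have := Walk.not_nil_iff_lt_length.1 hnil
    omega
  have h₃ := hX.dist_triangle (u := o) (v := p.penultimate) (w := x)
  rw [dist_eq_one_iff_adj.2 (p.adj_penultimate hnil)] at h₃
  omega

/-- A sphere of radius `n + 1` in a `d`-regular tree has at most `d * (d - 1) ^ n` vertices. -/
theorem SimpleGraph.Connected.exists_sphere [X.LocallyFinite] {d : ℕ} (hX : X.Connected)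
    (hreg : X.IsRegularOfDegree d) (o : V) (n : ℕ) :
    ∃ S : Finset V, (∀ x, x ∈ S ↔ X.dist o x = n + 1) ∧ S.card ≤ d * (d - 1) ^ n := by
  classical
  induction n with
  | zero =>
    refine ⟨X.neighborFinset o, fun x => ?_, ?_⟩
    · rw [mem_neighborFinset, zero_add, dist_eq_one_iff_adj]
    · rw [card_neighborFinset_eq_degree, hreg o, pow_zero, mul_one]
  | succ n ih =>
    obtain ⟨S, hS, hcard⟩ := ih
    refine ⟨S.biUnion fun v => (X.neighborFinset v).filter (X.dist o · = n + 1 + 1), fun x => ?_,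
      ?_⟩
    · simp only [Finset.mem_biUnion, Finset.mem_filter, mem_neighborFinset]
      constructor
      · rintro ⟨v, -, -, h⟩
        exact h
      · intro h
        obtain ⟨v, hv, hd⟩ := hX.exists_adj_dist_eq h
        exact ⟨v, (hS v).2 hd, hv, h⟩
    · have hle : ∀ v ∈ S, ((X.neighborFinset v).filter (X.dist o · = n + 1 + 1)).card ≤ d - 1 := by
        intro v hv
        obtain ⟨u, hu, hdu⟩ := hX.exists_adj_dist_eq ((hS v).1 hv)
        have hsub : (X.neighborFinset v).filter (X.dist o · = n + 1 + 1) ⊆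
            (X.neighborFinset v).erase u := by
          intro w hw
          rw [Finset.mem_filter] at hw
          refine Finset.mem_erase.2 ⟨?_, hw.1⟩
          rintro rfl
          omega
        refine (Finset.card_le_card hsub).trans ?_
        rw [Finset.card_erase_of_mem ((mem_neighborFinset _ _ _).2 hu.symm),
          card_neighborFinset_eq_degree, hreg v]
      calc _ ≤ S.card * (d - 1) := Finset.card_biUnion_le_card_mul _ _ _ hle
        _ ≤ d * (d - 1) ^ n * (d - 1) := Nat.mul_le_mul_right _ hcard
        _ = d * (d - 1) ^ (n + 1) := by rw [pow_succ, mul_assoc]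

theorem SimpleGraph.Connected.finite_dist_le [X.LocallyFinite] {d : ℕ} (hX : X.Connected)
    (hreg : X.IsRegularOfDegree d) (o : V) (n : ℕ) : {x | X.dist o x ≤ n}.Finite := by
  induction n with
  | zero =>
    refine (Set.finite_singleton o).subset fun x hx => ?_
    exact (hX.dist_eq_zero_iff.1 (Nat.le_zero.1 hx)).symm
  | succ n ih =>
    obtain ⟨S, hS, -⟩ := hX.exists_sphere hreg o n
    refine (ih.union S.finite_toSet).subset fun x hx => ?_
    rcases Nat.le_succ_iff.1 (show X.dist o x ≤ n + 1 from hx) with h | h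
    · exact Or.inl h
    · exact Or.inr ((hS x).2 h)

namespace GeodesicRay

variable {o : V}

theorem dist_origin (ξ : GeodesicRay X o) (n : ℕ) : X.dist o (ξ.vertex n) = n := by
  have := ξ.dist_vertex 0 n
  rwa [ξ.vertex_zero, zero_add] at this

theorem adj_vertex (ξ : GeodesicRay X o) (n : ℕ) : X.Adj (ξ.vertex n) (ξ.vertex (n + 1)) :=
  dist_eq_one_iff_adj.1 (ξ.dist_vertex n 1)

theorem vertex_eq_of_le (hX : X.IsTree) {ξ η : GeodesicRay X o} {n : ℕ}
    (h : ξ.vertex n = η.vertex n) {i : ℕ} (hi : i ≤ n) : ξ.vertex i = η.vertex i := by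
  induction hi using Nat.decreasingInduction with
  | self => exact h
  | of_succ i _ ih =>
    have hξ := ξ.adj_vertex i
    have hη := η.adj_vertex i
    rw [← ih] at hη
    refine hX.eq_of_adj_of_dist_eq (o := o) hξ hη ?_ ?_
    · rw [dist_origin, dist_origin]
    · rw [dist_origin, dist_origin]

theorem dist_le_of_vertex_eq {ξ η : GeodesicRay X o} {n : ℕ}
    (h : ∀ i ≤ n, ξ.vertex i = η.vertex i) : dist ξ η ≤ Real.exp (-n) := by
  change visualDist ξ η ≤ _
  unfold visualDist
  split_ifs with he
  · exact (Real.exp_pos _).le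
  · rw [Real.exp_le_exp, neg_le_neg_iff, Nat.cast_le]
    refine le_csInf (exists_ne_of_ne he) fun m hm => ?_
    by_contra! hlt
    exact hm (h (m + 1) hlt)

theorem exp_neg_le_dist {ξ η : GeodesicRay X o} {i n : ℕ} (hi : i ≤ n)
    (h : ξ.vertex i ≠ η.vertex i) : Real.exp (-n) ≤ dist ξ η := by
  change _ ≤ visualDist ξ η
  unfold visualDist
  rw [if_neg (fun he => h (by rw [he])), Real.exp_le_exp, neg_le_neg_iff, Nat.cast_le]
  cases i with
  | zero => exact absurd (by rw [ξ.vertex_zero, η.vertex_zero]) h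
  | succ i =>
    have : commonLength ξ η ≤ i := Nat.sInf_le h
    omega

/-- The Hausdorff dimension of the boundary of a `d`-regular tree is at most `log (d - 1)`: the
boundary is covered by one set of diameter `exp (-(n + 1))` for every vertex of the sphere of
radius `n + 1`. -/
theorem dimH_univ_le [X.LocallyFinite] {d : ℕ} (hd : 3 ≤ d) (hX : X.IsTree)
    (hreg : X.IsRegularOfDegree d) (o : V) :
    dimH (Set.univ : Set (GeodesicRay X o)) ≤ ENNReal.ofReal (Real.log ((d : ℝ) - 1)) := by
  borelize (GeodesicRay X o)
  have hd3 : (3 : ℝ) ≤ d := by exact_mod_cast hd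
  have hd1 : (0 : ℝ) < (d : ℝ) - 1 := by linarith
  have hlog : 0 ≤ Real.log ((d : ℝ) - 1) := Real.log_nonneg (by linarith)
  choose S hS hcard using hX.connected.exists_sphere hreg o
  refine dimH_le_of_hausdorffMeasure_ne_top (d := (Real.log ((d : ℝ) - 1)).toNNReal) ?_
  rw [Real.coe_toNNReal _ hlog]
  have hdiam : ∀ n (v : S n), Metric.ediam {ξ : GeodesicRay X o | ξ.vertex (n + 1) = v} ≤
      ENNReal.ofReal (Real.exp (-(n + 1 : ℕ))) := by
    intro n v
    refine Metric.ediam_le fun ξ hξ η hη => ?_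
    rw [edist_dist]
    exact ENNReal.ofReal_le_ofReal
      (dist_le_of_vertex_eq fun i hi => vertex_eq_of_le hX (hξ.trans hη.symm) hi)
  have hr : Filter.Tendsto (fun n : ℕ => ENNReal.ofReal (Real.exp (-(n + 1 : ℕ)))) Filter.atTop
      (nhds 0) := by
    rw [← ENNReal.ofReal_zero]
    refine ENNReal.tendsto_ofReal (Real.tendsto_exp_neg_atTop_nhds_zero.comp ?_)
    exact tendsto_natCast_atTop_atTop.comp (Filter.tendsto_add_atTop_nat 1)
  have hbound := MeasureTheory.Measure.hausdorffMeasure_le_liminf_sum (ι := fun n => S n)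
    (Real.log ((d : ℝ) - 1)) (Set.univ : Set (GeodesicRay X o)) _ hr
    (fun n v => {ξ | ξ.vertex (n + 1) = v}) (Filter.Eventually.of_forall hdiam)
    (Filter.Eventually.of_forall fun n ξ _ => Set.mem_iUnion.2
      ⟨⟨ξ.vertex (n + 1), (hS n _).2 (by rw [dist_origin])⟩, rfl⟩)
  have hsum : ∀ n, ∑ v : S n, Metric.ediam {ξ : GeodesicRay X o | ξ.vertex (n + 1) = v} ^
      Real.log ((d : ℝ) - 1) ≤ ENNReal.ofReal d := by
    intro n
    have hpow : ENNReal.ofReal (Real.exp (-(n + 1 : ℕ))) ^ Real.log ((d : ℝ) - 1) =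
        ENNReal.ofReal ((((d : ℝ) - 1) ^ (n + 1))⁻¹) := by
      rw [ENNReal.ofReal_rpow_of_pos (Real.exp_pos _), ← Real.exp_mul, neg_mul, Real.exp_neg,
        Real.exp_nat_mul, Real.exp_log hd1]
    calc _ ≤ ∑ _v : S n, ENNReal.ofReal ((((d : ℝ) - 1) ^ (n + 1))⁻¹) := by
          refine Finset.sum_le_sum fun v _ => ?_
          rw [← hpow]
          exact ENNReal.rpow_le_rpow (hdiam n v) hlog
      _ = ENNReal.ofReal ((S n).card * (((d : ℝ) - 1) ^ (n + 1))⁻¹) := by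
          rw [Finset.sum_const, Finset.card_univ, Fintype.card_coe, nsmul_eq_mul,
            ENNReal.ofReal_mul (Nat.cast_nonneg _), ENNReal.ofReal_natCast]
      _ ≤ ENNReal.ofReal d := by
          refine ENNReal.ofReal_le_ofReal ?_
          have h₁ : ((S n).card : ℝ) ≤ d * ((d : ℝ) - 1) ^ n := by
            have : ((S n).card : ℝ) ≤ ((d * (d - 1) ^ n : ℕ) : ℝ) := by exact_mod_cast hcard n
            rwa [Nat.cast_mul, Nat.cast_pow, Nat.cast_sub (by omega), Nat.cast_one] at this
          rw [← div_eq_mul_inv, div_le_iff₀ (by positivity), pow_succ]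
          have h₂ : (0 : ℝ) < ((d : ℝ) - 1) ^ n := by positivity
          have h₃ : (d : ℝ) * ((d : ℝ) - 1) ^ n ≤ d * (((d : ℝ) - 1) ^ n * (d - 1)) := by
            refine mul_le_mul_of_nonneg_left ?_ (Nat.cast_nonneg d)
            nlinarith
          linarith
  refine ne_top_of_le_ne_top (ENNReal.ofReal_ne_top (r := d)) (hbound.trans ?_)
  exact Filter.liminf_le_of_le (by isBoundedDefault)
    fun b hb => by
      obtain ⟨n, hn⟩ := hb.exists
      exact hn.trans (hsum n)

end GeodesicRay

end Tree

/-! ### Lifting walks from the quotient graph to the tree -/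

section Lift

variable {V : Type*} {X : SimpleGraph V} {G : Type*} [Group G] [MulAction G V]

variable (X G) in
/-- The vertex of the quotient graph below a vertex of `X`. -/
def quotientVertex (x : V) : (quotientGraph X G).V :=
  Quotient.mk (MulAction.orbitRel G V) x

variable (X G) in
/-- The vertices `x` and `y` are adjacent and the oriented edge from `x` to `y` lies over `e`. -/
def LiesOver (x y : V) (e : (quotientGraph X G).E) : Prop :=
  ∃ h : X.Adj x y, Quotient.mk (dartOrbitRel X G) ⟨(x, y), h⟩ = e

namespace LiesOver

variable {x y : V} {e e' : (quotientGraph X G).E}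

theorem src (h : LiesOver X G x y e) : (quotientGraph X G).src e = quotientVertex X G x := by
  obtain ⟨_, rfl⟩ := h
  rfl

theorem tgt (h : LiesOver X G x y e) : (quotientGraph X G).tgt e = quotientVertex X G y := by
  obtain ⟨_, rfl⟩ := h
  rfl

theorem rev (h : LiesOver X G x y e) : LiesOver X G y x ((quotientGraph X G).rev e) := by
  obtain ⟨h, rfl⟩ := h
  exact ⟨h.symm, rfl⟩

theorem unique (h : LiesOver X G x y e) (h' : LiesOver X G x y e') : e = e' := by
  obtain ⟨_, rfl⟩ := h
  obtain ⟨_, rfl⟩ := h'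
  rfl

end LiesOver

theorem quotientVertex_surjective (v : (quotientGraph X G).V) : ∃ x, quotientVertex X G x = v :=
  Quotient.exists_rep v

theorem quotientVertex_eq {x y : V} (h : quotientVertex X G x = quotientVertex X G y) :
    ∃ g : G, g • y = x :=
  Quotient.exact h

theorem quotientVertex_smul (g : G) (x : V) :
    quotientVertex X G (g • x) = quotientVertex X G x :=
  Quotient.sound ⟨g, rfl⟩

theorem exists_liesOver (hact : ActsByAutomorphisms X G) {x : V} {e : (quotientGraph X G).E}
    (h : (quotientGraph X G).src e = quotientVertex X G x) : ∃ y, LiesOver X G x y e := by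
  obtain ⟨a, rfl⟩ := Quotient.exists_rep e
  obtain ⟨g, hg⟩ := quotientVertex_eq (X := X) (G := G) (x := x) (y := a.fst) h.symm
  refine ⟨g • a.snd, ?_, Quotient.sound ⟨g⁻¹, ?_, ?_⟩⟩
  · rw [← hg, hact]
    exact a.adj
  · exact inv_smul_eq_iff.2 hg.symm
  · exact inv_smul_smul g a.snd

theorem quotientGraph_isConnectedSet (hX : X.Connected) :
    (quotientGraph X G).IsConnectedSet Set.univ := by
  intro u _ v _
  obtain ⟨x, rfl⟩ := quotientVertex_surjective u
  obtain ⟨y, rfl⟩ := quotientVertex_surjective v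
  obtain ⟨p⟩ := hX.preconnected x y
  induction p with
  | nil => exact .refl
  | cons h _ ih =>
    have hl : LiesOver X G _ _ _ := ⟨h, rfl⟩
    exact .head ⟨trivial, trivial, _, hl.src, hl.tgt⟩ (ih trivial trivial)

theorem ActsByAutomorphisms.dist_smul (hact : ActsByAutomorphisms X G) (hX : X.Connected) (g : G)
    (x y : V) : X.dist (g • x) (g • y) = X.dist x y := by
  have hle : ∀ (g : G) x y, X.dist (g • x) (g • y) ≤ X.dist x y := by
    intro g x y
    obtain ⟨p, hp⟩ := hX.exists_walk_length_eq_dist x y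
    rw [← hp, ← p.length_map (⟨(g • ·), fun h => (hact g _ _).2 h⟩ : X →g X)]
    exact X.dist_le _
  refine le_antisymm (hle g x y) ?_
  have := hle g⁻¹ (g • x) (g • y)
  rwa [inv_smul_smul, inv_smul_smul] at this

open Classical in
variable (X G) in
/-- The vertices of the lift, starting at `o`, of a walk in the quotient graph that is given by the
sequence `w` of its oriented edges. If `w` fails to be a walk the lift stops moving. -/
noncomputable def liftWalk (o : V) (w : ℕ → (quotientGraph X G).E) : ℕ → V
  | 0 => o
  | n + 1 => if h : ∃ y, LiesOver X G (liftWalk o w n) y (w n) then h.choose else liftWalk o w n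

theorem liftWalk_congr {o : V} {w w' : ℕ → (quotientGraph X G).E} {n : ℕ}
    (h : ∀ i < n, w i = w' i) : liftWalk X G o w n = liftWalk X G o w' n := by
  induction n with
  | zero => rfl
  | succ n ih =>
    have h₁ := ih fun i hi => h i (by omega)
    have h₂ := h n (by omega)
    simp only [liftWalk]
    rw [h₁, h₂]

theorem liesOver_liftWalk (hact : ActsByAutomorphisms X G) {o : V}
    {w : ℕ → (quotientGraph X G).E} (h0 : (quotientGraph X G).src (w 0) = quotientVertex X G o)
    {N : ℕ} (hw : ∀ i < N, (quotientGraph X G).NBStep Set.univ (w i) (w (i + 1))) {i : ℕ}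
    (hi : i ≤ N) : LiesOver X G (liftWalk X G o w i) (liftWalk X G o w (i + 1)) (w i) := by
  have key : ∀ n, (quotientGraph X G).src (w n) = quotientVertex X G (liftWalk X G o w n) →
      LiesOver X G (liftWalk X G o w n) (liftWalk X G o w (n + 1)) (w n) := by
    intro n hn
    have hex := exists_liesOver hact hn
    rw [liftWalk, dif_pos hex]
    exact hex.choose_spec
  induction i with
  | zero => exact key 0 h0
  | succ i ih =>
    have h := ih (by omega)
    refine key (i + 1) ?_
    rw [(hw i (by omega)).2.2.2.1, h.tgt]

/-- Lifts of non-backtracking walks are geodesics. -/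
theorem dist_liftWalk (hX : X.IsTree) (hact : ActsByAutomorphisms X G) {o : V}
    {w : ℕ → (quotientGraph X G).E} (h0 : (quotientGraph X G).src (w 0) = quotientVertex X G o)
    {N : ℕ} (hw : ∀ i < N, (quotientGraph X G).NBStep Set.univ (w i) (w (i + 1))) (m k : ℕ)
    (hmk : m + k ≤ N + 1) : X.dist (liftWalk X G o w m) (liftWalk X G o w (m + k)) = k := by
  have hl : ∀ i < N + 1, LiesOver X G (liftWalk X G o w i) (liftWalk X G o w (i + 1)) (w i) :=
    fun i hi => liesOver_liftWalk hact h0 hw (by omega)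
  refine hX.dist_of_nonbacktracking (fun i hi => (hl i hi).1) (fun i hi heq => ?_) m k hmk
  have h₁ := hl (i + 1) (by omega)
  rw [show i + 1 + 1 = i + 2 from rfl, heq] at h₁
  exact (hw i (by omega)).2.2.2.2 (h₁.unique (hl i (by omega)).rev)

/-- The geodesic ray that lifts an infinite non-backtracking walk. -/
noncomputable def liftRay (hX : X.IsTree) (hact : ActsByAutomorphisms X G) {o : V}
    (w : ℕ → (quotientGraph X G).E) (h0 : (quotientGraph X G).src (w 0) = quotientVertex X G o)
    (hw : ∀ i, (quotientGraph X G).NBStep Set.univ (w i) (w (i + 1))) : GeodesicRay X o where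
  vertex := liftWalk X G o w
  vertex_zero := rfl
  dist_vertex m k := dist_liftWalk (N := m + k) hX hact h0 (fun i _ => hw i) m k (by omega)

end Lift

/-! ### Coding binary sequences by infinite walks -/

section Coding

variable {α : Type*}

theorem IsWalk.rel_getElem? {R : α → α → Prop} {a b : α} {l : List α} (h : IsWalk R a l b) {i : ℕ}
    {x y : α} (hx : (a :: l)[i]? = some x) (hy : (a :: l)[i + 1]? = some y) : R x y := by
  rw [List.getElem?_cons_succ, List.getElem?_eq_some_iff] at hy
  obtain ⟨hi, rfl⟩ := hy
  rw [List.getElem?_eq_some_iff] at hx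
  obtain ⟨_, rfl⟩ := hx
  exact h.rel_getElem i hi

theorem IsWalk.getElem?_append {R : α → α → Prop} {a b : α} {l : List α} (h : IsWalk R a l b)
    (l' : List α) (i : ℕ) : (a :: (l ++ l'))[l.length + i]? = (b :: l')[i]? := by
  induction l generalizing a with
  | nil => cases h; simp
  | cons x l ih =>
    rw [List.length_cons, show l.length + 1 + i = (l.length + i) + 1 by omega,
      List.getElem?_cons_succ]
    exact ih h.2

/-- Lists that encode a positive amount of information are nonempty. -/
theorem length_pos_of_injective {s : ℝ} (hs : 0 ≤ s) {L m : ℕ} (hLm : s * L < m * Real.log 2)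
    {B : (Fin m → Fin 2) → List α} (hinj : Function.Injective B) (hB : ∀ x, (B x).length = L) :
    0 < L := by
  by_contra! h0
  have hm : 0 < m := by
    rcases Nat.eq_zero_or_pos m with rfl | h
    · have : 0 ≤ s * L := by positivity
      simp at hLm
      linarith
    · exact h
  have hnil : ∀ x, B x = [] := fun x => by
    rw [← List.length_eq_zero_iff, hB x]
    omega
  have := congrFun (hinj ((hnil fun _ => 0).trans (hnil fun _ => 1).symm)) ⟨0, hm⟩
  simp at this

/-- Closed walks `B n` at `e n` of length `L n`, encoding `m n` bits each, and transition walks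
`T n` from `e n` to `e (n + 1)` are concatenated to infinite walks `w x` indexed by binary sequences
`x`. The walks follow the relations `R n` one after the other, and the entropy `s` that each of
the families `B n` exceeds is retained: distinct `x`, `y` with `b` common initial bits lead to walks
that are distinct after at most `(b * log 2 + C) / s` steps. -/
theorem exists_coding {R : ℕ → α → α → Prop} (hR : Antitone R) {e : ℕ → α} {f : α} {T₀ : List α}
    (hT₀ : IsWalk (R 0) f T₀ (e 0)) {T : ℕ → List α}
    (hT : ∀ n, IsWalk (R n) (e n) (T n) (e (n + 1))) (hTne : ∀ n, T n ≠ []) {L m : ℕ → ℕ}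
    {s : ℝ} (hs : 0 < s) (hLm : ∀ n, s * L n < m n * Real.log 2)
    {B : ∀ n, (Fin (m n) → Fin 2) → List α} (hinj : ∀ n, Function.Injective (B n))
    (hB : ∀ n x, (B n x).length = L n ∧ IsWalk (R n) (e n) (B n x) (e n)) :
    ∃ w : (ℕ → Fin 2) → ℕ → α, (∀ x, w x 0 = f) ∧ (∀ x i, R 0 (w x i) (w x (i + 1))) ∧
      (∀ n, ∃ N, ∀ x, ∀ i ≥ N, R n (w x i) (w x (i + 1))) ∧
      (∀ x N, ∃ i ≥ N, ∃ n, w x i = e n) ∧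
      ∃ C : ℝ, ∀ x y, x ≠ y → ∃ b i : ℕ, (∀ k < b, x k = y k) ∧ w x i ≠ w y i ∧
        s * i ≤ b * Real.log 2 + C := by
  classical
  have hlog2 : 0 < Real.log 2 := Real.log_pos one_lt_two
  have hLpos : ∀ n, 0 < L n := fun n =>
    length_pos_of_injective hs.le (hLm n) (hinj n) fun x => (hB n x).1
  -- The state consists of the index `n` of the current family, the number of bits that have been
  -- read, and the length of the walk. The transition to the next family is made as soon as the walk
  -- extended by the transition and by one more closed walk, neither of which counts as reading any
  -- bits, still encodes `s / log 2` bits per step.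
  let P : ℕ × ℕ × ℕ → Prop := fun p =>
    s * (p.2.2 + (T p.1).length + L (p.1 + 1)) ≤ p.2.1 * Real.log 2
  let step : ℕ × ℕ × ℕ → ℕ × ℕ × ℕ := fun p =>
    if P p then (p.1 + 1, p.2.1, p.2.2 + (T p.1).length)
    else (p.1, p.2.1 + m p.1, p.2.2 + L p.1)
  let st : ℕ → ℕ × ℕ × ℕ := fun j => step^[j] (0, 0, T₀.length)
  have hst : ∀ j, st (j + 1) = step (st j) := fun j => Function.iterate_succ_apply' _ _ _
  have hst_pos : ∀ j, P (st j) →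
      st (j + 1) = ((st j).1 + 1, (st j).2.1, (st j).2.2 + (T (st j).1).length) := fun j hj => by
    rw [hst]
    exact if_pos hj
  have hst_neg : ∀ j, ¬ P (st j) →
      st (j + 1) = ((st j).1, (st j).2.1 + m (st j).1, (st j).2.2 + L (st j).1) := fun j hj => by
    rw [hst]
    exact if_neg hj
  let D : (ℕ → Fin 2) → ℕ → List α := fun x j =>
    if P (st j) then T (st j).1 else B (st j).1 fun i => x ((st j).2.1 + i)
  let W : (ℕ → Fin 2) → ℕ → List α := fun x j => Nat.rec T₀ (fun j l => l ++ D x j) j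
  have hWsucc : ∀ x j, W x (j + 1) = W x j ++ D x j := fun _ _ => rfl
  have hD : ∀ x j, (st (j + 1)).2.2 = (st j).2.2 + (D x j).length ∧
      IsWalk (R (st j).1) (e (st j).1) (D x j) (e (st (j + 1)).1) := by
    intro x j
    by_cases hP : P (st j)
    · simp only [D, if_pos hP, hst_pos j hP]
      exact ⟨trivial, hT _⟩
    · simp only [D, if_neg hP, hst_neg j hP]
      exact ⟨by rw [(hB _ _).1], (hB _ _).2⟩
  have hlen : ∀ x j, (W x j).length = (st j).2.2 := by
    intro x j
    induction j with
    | zero => rfl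
    | succ j ih => rw [hWsucc, List.length_append, ih, (hD x j).1]
  have hn_mono : Monotone fun j => (st j).1 := monotone_nat_of_le_succ fun j => by
    by_cases hP : P (st j)
    · simp [hst_pos j hP]
    · simp [hst_neg j hP]
  have hl_strict : StrictMono fun j => (st j).2.2 := strictMono_nat_of_lt_succ fun j => by
    by_cases hP : P (st j)
    · simp [hst_pos j hP, List.length_pos_iff.2 (hTne _)]
    · simp [hst_neg j hP, hLpos]
  have hl_le : ∀ j, j ≤ (st j).2.2 := hl_strict.id_le
  -- Walks between two times.
  have htail : ∀ x j k, ∃ l, W x (j + k) = W x j ++ l ∧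
      IsWalk (R (st j).1) (e (st j).1) l (e (st (j + k)).1) := by
    intro x j k
    induction k with
    | zero => exact ⟨[], by simp, rfl⟩
    | succ k ih =>
      obtain ⟨l, h₁, h₂⟩ := ih
      refine ⟨l ++ D x (j + k), ?_, h₂.append ?_⟩
      · rw [← add_assoc, hWsucc, h₁, List.append_assoc]
      · exact (hD x (j + k)).2.mono fun a b hab => hR (hn_mono (Nat.le_add_right j k)) a b hab
  have hwalk : ∀ x j, IsWalk (R 0) f (W x j) (e (st j).1) := by
    intro x j
    obtain ⟨l, h₁, h₂⟩ := htail x 0 j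
    rw [zero_add] at h₁ h₂
    rw [h₁]
    exact hT₀.append h₂
  have hne : ∀ x i, ∃ a, (f :: W x i)[i]? = some a := by
    intro x i
    refine ⟨_, List.getElem?_eq_getElem ?_⟩
    rw [List.length_cons, hlen]
    have := hl_le i
    omega
  choose w hw using hne
  have hwj : ∀ x j i, i ≤ (st j).2.2 → (f :: W x j)[i]? = some (w x i) := by
    intro x j i hi
    have hi' := hl_le i
    rw [← hw x i]
    rcases le_total i j with h | h
    · obtain ⟨k, rfl⟩ := Nat.exists_eq_add_of_le h
      obtain ⟨l, h₁, -⟩ := htail x i k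
      rw [h₁, ← List.cons_append, List.getElem?_append_left]
      rw [List.length_cons, hlen]
      omega
    · obtain ⟨k, rfl⟩ := Nat.exists_eq_add_of_le h
      obtain ⟨l, h₁, -⟩ := htail x j k
      rw [h₁, ← List.cons_append, List.getElem?_append_left]
      rw [List.length_cons, hlen]
      omega
  -- The transitions do take place.
  have hn_unbounded : ∀ n, ∃ j, (st j).1 = n := by
    intro n
    induction n with
    | zero => exact ⟨0, rfl⟩
    | succ n ih =>
      obtain ⟨j, rfl⟩ := ih
      by_contra! hno
      have hstay : ∀ k, st (j + k) =
          ((st j).1, (st j).2.1 + k * m (st j).1, (st j).2.2 + k * L (st j).1) := by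
        intro k
        induction k with
        | zero => simp
        | succ k ih =>
          have hP : ¬ P (st (j + k)) := by
            intro hP
            refine hno (j + k + 1) ?_
            rw [hst_pos _ hP, ih]
          rw [← add_assoc, hst_neg _ hP, ih]
          simp only [Prod.mk.injEq, true_and]
          constructor <;> ring
      have hgap : 0 < m (st j).1 * Real.log 2 - s * L (st j).1 := sub_pos.2 (hLm _)
      obtain ⟨k, hk⟩ := exists_nat_gt
        (s * ((st j).2.2 + (T (st j).1).length + L ((st j).1 + 1)) /
          (m (st j).1 * Real.log 2 - s * L (st j).1))
      rw [div_lt_iff₀ hgap] at hk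
      refine hno (j + k + 1) ?_
      have hP : P (st (j + k)) := by
        simp only [P, hstay k]
        push_cast
        have : 0 ≤ ((st j).2.1 : ℝ) * Real.log 2 := by positivity
        nlinarith
      rw [hst_pos _ hP, hstay k]
  set C : ℝ := s * (T₀.length + L 0) with hC
  have hC0 : 0 ≤ C := by positivity
  have hinv : ∀ j, s * ((st j).2.2 + L (st j).1) ≤ (st j).2.1 * Real.log 2 + C := by
    intro j
    induction j with
    | zero => simp [st, hC]
    | succ j ih =>
      by_cases hP : P (st j)
      · rw [hst_pos j hP]
        have hP' : s * ((st j).2.2 + (T (st j).1).length + L ((st j).1 + 1)) ≤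
          (st j).2.1 * Real.log 2 := hP
        push_cast
        linarith
      · rw [hst_neg j hP]
        have := hLm (st j).1
        push_cast
        linarith
  have hlen_bits : ∀ j, s * (st (j + 1)).2.2 ≤ (st j).2.1 * Real.log 2 + C := by
    intro j
    by_cases hP : P (st j)
    · rw [hst_pos j hP]
      have hP' : s * ((st j).2.2 + (T (st j).1).length + L ((st j).1 + 1)) ≤
        (st j).2.1 * Real.log 2 := hP
      have : 0 ≤ s * L ((st j).1 + 1) := by positivity
      push_cast
      linarith
    · rw [hst_neg j hP]
      have := hinv j
      push_cast
      linarith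
  refine ⟨w, fun x => ?_, fun x i => ?_, fun n => ?_, fun x N => ?_, C, fun x y hxy => ?_⟩
  · have := hw x 0
    simpa using this.symm
  · have hi := hl_le (i + 1)
    exact (hwalk x (i + 1)).rel_getElem? (hwj x (i + 1) i (by omega)) (hwj x (i + 1) (i + 1) hi)
  · obtain ⟨j, rfl⟩ := hn_unbounded n
    refine ⟨(st j).2.2, fun x i hi => ?_⟩
    obtain ⟨k, rfl⟩ := Nat.exists_eq_add_of_le hi
    obtain ⟨l, h₁, h₂⟩ := htail x j ((st j).2.2 + k + 1)
    have hle := hl_le (j + ((st j).2.2 + k + 1))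
    have h₃ := hwj x (j + ((st j).2.2 + k + 1)) ((st j).2.2 + k) (by omega)
    have h₄ := hwj x (j + ((st j).2.2 + k + 1)) ((st j).2.2 + k + 1) (by omega)
    rw [h₁, ← hlen x j] at h₃ h₄
    rw [(hwalk x j).getElem?_append] at h₃
    rw [add_assoc, (hwalk x j).getElem?_append] at h₄
    rw [← hlen x j]
    exact h₂.rel_getElem? h₃ h₄
  · refine ⟨(st N).2.2, hl_le N, (st N).1, ?_⟩
    have h₁ := hwj x N _ le_rfl
    have h₂ := (hwalk x N).getElem?_append [] 0
    rw [add_zero, List.append_nil, hlen, h₁] at h₂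
    simpa using h₂
  · obtain ⟨t, ht⟩ := Function.ne_iff.1 hxy
    have hex : ∃ k, x k ≠ y k := ⟨t, ht⟩
    -- The block that reads the first bit at which `x` and `y` differ.
    have hbits : ∃ j, Nat.find hex < (st j).2.1 := by
      obtain ⟨j, hj⟩ := exists_nat_gt ((Nat.find hex * Real.log 2 + C) / s)
      rw [div_lt_iff₀ hs] at hj
      refine ⟨j, ?_⟩
      by_contra! hle
      have h₁ := hlen_bits j
      have h₂ : (j : ℝ) ≤ (st (j + 1)).2.2 := by
        have := hl_le (j + 1)
        exact_mod_cast (by omega : j ≤ (st (j + 1)).2.2)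
      have h₃ : ((st j).2.1 : ℝ) ≤ Nat.find hex := by exact_mod_cast hle
      nlinarith
    obtain ⟨j, hj⟩ : ∃ j, Nat.find hbits = j + 1 := by
      refine Nat.exists_eq_succ_of_ne_zero fun h0 => ?_
      have := Nat.find_spec hbits
      rw [h0] at this
      exact absurd this (Nat.not_lt_zero _)
    have hj₁ : Nat.find hex < (st (j + 1)).2.1 := hj ▸ Nat.find_spec hbits
    have hj₂ : (st j).2.1 ≤ Nat.find hex := not_lt.1 (Nat.find_min hbits (m := j) (by omega))
    have hWne : W x (j + 1) ≠ W y (j + 1) := by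
      intro heq
      rw [hWsucc, hWsucc] at heq
      have hDeq := (List.append_inj heq (by rw [hlen, hlen])).2
      by_cases hP : P (st j)
      · rw [hst_pos j hP] at hj₁
        exact absurd hj₁ (by simpa using hj₂)
      · simp only [D, if_neg hP] at hDeq
        rw [hst_neg j hP] at hj₁
        obtain ⟨k, hk⟩ := Nat.exists_eq_add_of_le hj₂
        have := congrFun (hinj _ hDeq) ⟨k, by simp only at hj₁; omega⟩
        simp only [← hk] at this
        exact Nat.find_spec hex this
    obtain ⟨i, hi, hne⟩ : ∃ i ≤ (st (j + 1)).2.2, w x i ≠ w y i := by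
      by_contra! hall
      refine hWne (List.cons_injective (a := f) (List.ext_getElem? fun i => ?_))
      by_cases hi : i ≤ (st (j + 1)).2.2
      · rw [hwj x _ i hi, hwj y _ i hi, hall i hi]
      · rw [List.getElem?_eq_none, List.getElem?_eq_none] <;>
        · have := hlen x (j + 1)
          have := hlen y (j + 1)
          rw [List.length_cons]
          omega
    refine ⟨(st j).2.1, i, fun k hk => ?_, hne, ?_⟩
    · exact not_not.1 (Nat.find_min hex (hk.trans_le hj₂))
    · refine le_trans ?_ (hlen_bits j)
      exact mul_le_mul_of_nonneg_left (by exact_mod_cast hi) hs.le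

end Coding

/-! ### Limit points of lifted walks -/

section LimitPoints

variable {V : Type*} {X : SimpleGraph V} {G : Type*} [Group G] [MulAction G V]

/-- A ray whose projection leaves every ball of the quotient graph is not conical. -/
theorem notMem_conicalLimitSet (hX : X.Connected) (hact : ActsByAutomorphisms X G) {o : V}
    {ξ : GeodesicRay X o} (h : ∀ R : ℕ, ∃ N, ∀ k ≥ N, ∀ x, X.dist o x ≤ R →
      quotientVertex X G (ξ.vertex k) ≠ quotientVertex X G x) :
    ξ ∉ conicalLimitSet X G o := by
  rintro ⟨g, hlim, R, hR⟩
  choose k hk using hR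
  obtain ⟨N, hN⟩ := h R
  have hkN : ∀ n, k n < N := by
    intro n
    by_contra! hle
    refine hN (k n) hle ((g n)⁻¹ • ξ.vertex (k n)) ?_ (quotientVertex_smul _ _).symm
    have := hk n
    rwa [← hact.dist_smul hX (g n)⁻¹, inv_smul_smul] at this
  obtain ⟨n, hn⟩ := (hlim (N + R)).exists
  have h₁ := hX.dist_triangle (u := o) (v := ξ.vertex (k n)) (w := g n • o)
  rw [X.dist_comm (u := ξ.vertex (k n))] at h₁
  beta_reduce at hn
  rw [ξ.dist_origin] at hn h₁
  have h₂ := hk n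
  have h₃ := hkN n
  omega

/-- The lift of a non-backtracking walk that at arbitrarily late times may be continued to the
projection of `o` is a limit point. -/
theorem liftRay_mem_limitSet (hX : X.IsTree) (hact : ActsByAutomorphisms X G) {o : V}
    {w : ℕ → (quotientGraph X G).E} (h0 : (quotientGraph X G).src (w 0) = quotientVertex X G o)
    (hw : ∀ i, (quotientGraph X G).NBStep Set.univ (w i) (w (i + 1)))
    (hret : ∀ N, ∃ i ≥ N, ∃ f, Relation.ReflTransGen ((quotientGraph X G).NBStep Set.univ) (w i) f ∧
      (quotientGraph X G).tgt f = quotientVertex X G o) :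
    liftRay hX hact w h0 hw ∈ limitSet X G o := by
  have key : ∀ n, ∃ g : G, ∀ k ≤ n, X.dist o (liftWalk X G o w k) +
      X.dist (liftWalk X G o w k) (g • o) = X.dist o (g • o) := by
    intro n
    obtain ⟨i, hi, f, hf, hft⟩ := hret n
    obtain ⟨l, hl⟩ := exists_isWalk hf
    let w' : ℕ → (quotientGraph X G).E := fun k => if k < i then w k else (w i :: l).getD (k - i) f
    have hlow : ∀ k ≤ i, w' k = w k := by
      intro k hk
      rcases hk.lt_or_eq with h | rfl
      · simp only [w', if_pos h]
      · simp [w']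
    have hhigh : ∀ k, w' (i + k) = (w i :: l).getD k f := by
      intro k
      simp [w']
    have hw' : ∀ k < i + l.length,
        (quotientGraph X G).NBStep Set.univ (w' k) (w' (k + 1)) := by
      intro k hk
      rcases lt_or_ge k i with h | h
      · rw [hlow k h.le, hlow (k + 1) h]
        exact hw k
      · obtain ⟨j, rfl⟩ := Nat.exists_eq_add_of_le h
        rw [add_assoc, hhigh, hhigh]
        have := hl.rel_getElem j (by omega)
        rwa [List.getD_eq_getElem _ _ (by simp; omega), List.getD_cons_succ,
          List.getD_eq_getElem _ _ (by omega)]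
    have h0' : (quotientGraph X G).src (w' 0) = quotientVertex X G o := by
      rw [hlow 0 (Nat.zero_le _), h0]
    have hend : w' (i + l.length) = f := by
      rw [hhigh, List.getD_eq_getElem _ _ (by simp), hl.getElem_length]
    have hover := liesOver_liftWalk hact h0' hw' le_rfl
    rw [hend] at hover
    obtain ⟨g, hg⟩ := quotientVertex_eq (hover.tgt.symm.trans hft)
    refine ⟨g, fun k hk => ?_⟩
    have hcongr : liftWalk X G o w k = liftWalk X G o w' k :=
      liftWalk_congr fun j hj => (hlow j (by omega)).symm
    have h₁ := dist_liftWalk hX hact h0' hw' 0 k (by omega)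
    have h₂ := dist_liftWalk hX hact h0' hw' k (i + l.length + 1 - k) (by omega)
    have h₃ := dist_liftWalk hX hact h0' hw' 0 (i + l.length + 1) (by omega)
    rw [zero_add] at h₁ h₃
    rw [show k + (i + l.length + 1 - k) = i + l.length + 1 by omega] at h₂
    rw [hg, hcongr]
    change X.dist o _ = _ at h₁ h₃
    omega
  choose g hg using key
  exact ⟨g, fun k => Filter.eventually_atTop.2 ⟨k, fun n hn => hg n k hn⟩⟩

/-- A set of rays parametrized by the binary sequences in such a way that rays of sequences with
`b` common initial bits part after at most `(b * log 2 + C) / s` steps has dimension at least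
`s`. -/
theorem le_dimH_of_coding {o : V} {K : Set (GeodesicRay X o)} {s : NNReal} (hs : 0 < s)
    (φ : (ℕ → Fin 2) → GeodesicRay X o) (hφ : ∀ x, φ x ∈ K) (C : ℝ)
    (h : ∀ x y, x ≠ y → ∃ b i : ℕ, (∀ k < b, x k = y k) ∧ (φ x).vertex i ≠ (φ y).vertex i ∧
      s * i ≤ b * Real.log 2 + C) : (s : ENNReal) ≤ dimH K := by
  classical
  have hinj : Function.Injective φ := by
    intro x y hxy
    by_contra hne
    obtain ⟨b, i, -, hi, -⟩ := h x y hne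
    exact hi (by rw [hxy])
  -- The binary expansion is a Hölder map from the range of `φ` onto the unit interval.
  let F : GeodesicRay X o → ℝ := fun ξ => Real.ofDigits (Function.invFun φ ξ)
  have hF : ∀ x, F (φ x) = Real.ofDigits x := fun x => by
    simp only [F, Function.leftInverse_invFun hinj x]
  have hhold : HolderOnWith (Real.exp C).toNNReal s F (Set.range φ) := by
    rintro _ ⟨x, rfl⟩ _ ⟨y, rfl⟩
    by_cases hxy : x = y
    · rw [hxy, edist_self]
      exact zero_le
    obtain ⟨b, i, hb, hi, hsi⟩ := h x y hxy
    rw [hF, hF, edist_dist, edist_dist, ENNReal.ofReal_rpow_of_nonneg dist_nonneg s.coe_nonneg,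
      ← ENNReal.ofReal_coe_nnreal, Real.coe_toNNReal _ (Real.exp_pos _).le,
      ← ENNReal.ofReal_mul (Real.exp_pos _).le]
    refine ENNReal.ofReal_le_ofReal ?_
    have h₁ : Real.exp (-i) ^ (s : ℝ) ≤ dist (φ x) (φ y) ^ (s : ℝ) :=
      Real.rpow_le_rpow (Real.exp_pos _).le (GeodesicRay.exp_neg_le_dist le_rfl hi) s.coe_nonneg
    calc dist (Real.ofDigits x) (Real.ofDigits y) ≤ (((2 : ℕ) : ℝ) ^ b)⁻¹ :=
          Real.abs_ofDigits_sub_ofDigits_le hb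
      _ = Real.exp (-(b * Real.log 2)) := by
          rw [Real.exp_neg, Real.exp_nat_mul, Real.exp_log two_pos, Nat.cast_ofNat]
      _ ≤ Real.exp (C + -i * s) := Real.exp_le_exp.2 (by linarith)
      _ = Real.exp C * Real.exp (-i) ^ (s : ℝ) := by rw [Real.exp_add, Real.exp_mul]
      _ ≤ Real.exp C * dist (φ x) (φ y) ^ (s : ℝ) :=
          mul_le_mul_of_nonneg_left h₁ (Real.exp_pos _).le
  have himage : Set.Ico (0 : ℝ) 1 ⊆ F '' Set.range φ := by
    intro t ht
    exact ⟨_, ⟨Real.digits t 2, rfl⟩, by rw [hF, Real.ofDigits_digits one_lt_two ht]⟩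
  have hdim : (1 : ENNReal) ≤ dimH (F '' Set.range φ) := by
    refine le_trans (le_of_eq ?_) (dimH_mono himage)
    rw [Real.dimH_of_nonempty_interior (by simp), Module.finrank_self, Nat.cast_one]
  have hle := hdim.trans (hhold.dimH_image_le hs)
  rw [ENNReal.le_div_iff_mul_le (Or.inl (by simpa using hs.ne')) (Or.inl ENNReal.coe_ne_top),
    one_mul] at hle
  exact hle.trans (dimH_mono (Set.range_subset_iff.2 hφ))

theorem liftRay_vertex_ne (hX : X.IsTree) (hact : ActsByAutomorphisms X G) {o : V}
    {w w' : ℕ → (quotientGraph X G).E} (h0 : (quotientGraph X G).src (w 0) = quotientVertex X G o)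
    (h0' : (quotientGraph X G).src (w' 0) = quotientVertex X G o)
    (hw : ∀ i, (quotientGraph X G).NBStep Set.univ (w i) (w (i + 1)))
    (hw' : ∀ i, (quotientGraph X G).NBStep Set.univ (w' i) (w' (i + 1))) {i : ℕ}
    (hi : w i ≠ w' i) :
    (liftRay hX hact w h0 hw).vertex (i + 1) ≠ (liftRay hX hact w' h0' hw').vertex (i + 1) := by
  intro h
  have h₁ := GeodesicRay.vertex_eq_of_le hX h (Nat.le_succ i)
  have h₂ := liesOver_liftWalk hact h0 (fun j _ => hw j) (le_refl i)
  have h₃ := liesOver_liftWalk hact h0' (fun j _ => hw' j) (le_refl i)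
  change liftWalk X G o w (i + 1) = liftWalk X G o w' (i + 1) at h
  change liftWalk X G o w i = liftWalk X G o w' i at h₁
  rw [h, h₁] at h₂
  exact hi (h₂.unique h₃)

end LimitPoints

theorem theorem5p11 {V G : Type*} [Group G] [MulAction G V] (X : SimpleGraph V)
    [X.LocallyFinite] (d : ℕ) (hd : 3 ≤ d) (hX : X.IsTree) (hreg : X.IsRegularOfDegree d)
    (hact : ActsByAutomorphisms X G) (hproper : ActsProperly X G)
    (hqreg : (quotientGraph X G).IsRegularOfDegree d)
    (hinf : Infinite (quotientGraph X G).V)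
    (hamen : (quotientGraph X G).IsAmenable d) (o : V) :
    dimH (nonconicalLimitSet X G o) = ENNReal.ofReal (Real.log ((d : ℝ) - 1)) := by
  refine le_antisymm ((dimH_mono (Set.subset_univ _)).trans
    (GeodesicRay.dimH_univ_le hd hX hreg o)) (le_of_forall_lt fun c hc => ?_)
  have hd0 : 0 < d := by omega
  -- It suffices to bound the dimension below by any positive real `s < log (d - 1)`.
  obtain ⟨s, hcs, hs⟩ := ENNReal.lt_iff_exists_nnreal_btwn.1 hc
  refine hcs.trans_le ?_
  have hs0 : 0 < s := by exact_mod_cast (zero_le (a := c)).trans_lt hcs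
  have hsd : (s : ℝ) < Real.log (d - 1) := by
    rw [← ENNReal.ofReal_coe_nnreal, ENNReal.ofReal_lt_ofReal_iff_of_nonneg s.coe_nonneg] at hs
    exact hs
  set Γ := quotientGraph X G
  have hconn : Γ.IsConnectedSet Set.univ := quotientGraph_isConnectedSet hX.connected
  have hU := hamen.isAmenableSet_univ hd0
  obtain ⟨U, hU0, hUanti, hUam, hUconn, hUdisj⟩ := Γ.exists_amenable_end hqreg hd0 hconn hU
    (fun n => quotientVertex X G '' {x | X.dist o x ≤ n})
    fun n => (hX.connected.finite_dist_le hreg o n).image _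
  choose e hes het herev L m B hLm hBinj hB using fun n =>
    (hUam n).exists_closed_walks hqreg hd s.coe_nonneg hsd
  -- From each reversible edge the base vertex is reached in the whole graph.
  have hbase : ∀ n f, Γ.IsReversible (U n) f → ∃ g,
      Relation.ReflTransGen (Γ.NBStep Set.univ) f g ∧ Γ.tgt g = quotientVertex X G o := by
    intro n f hf
    obtain ⟨g, hg, -, hgt⟩ := (hf.mono (Set.subset_univ _)).exists_reach_vertex hconn trivial
      trivial (Set.mem_univ (quotientVertex X G o))
    exact ⟨g, hg, hgt⟩
  obtain ⟨f, T₀, hf, hT₀⟩ : ∃ f T₀, Γ.src f = quotientVertex X G o ∧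
      IsWalk (Γ.NBStep (U 0)) f T₀ (e 0) := by
    obtain ⟨g, hg, hgt⟩ := hbase 0 _ (herev 0).rev
    have := OrientedMultigraph.reflTransGen_nbStep_rev hg
    rw [Γ.rev_rev] at this
    obtain ⟨T₀, hT₀⟩ := exists_isWalk this
    exact ⟨Γ.rev g, T₀, (Γ.src_rev g).trans hgt, hU0 ▸ hT₀⟩
  have hT : ∀ n, ∃ T, IsWalk (Γ.NBStep (U n)) (e n) T (e (n + 1)) ∧ T ≠ [] := by
    intro n
    have hle := hUanti (Nat.le_succ n)
    obtain ⟨T, hT⟩ := exists_isWalk ((herev n).reach (hUconn n) (hes n) (het n) (herev (n + 1)) hle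
      (hle (hes _)) (hle (het _)))
    -- A closed walk at `e n` that has positive length makes the transition nontrivial.
    refine ⟨B n 0 ++ T, (hB n 0).2.append hT, fun h0 => ?_⟩
    have h₁ := length_pos_of_injective s.coe_nonneg (hLm n) (hBinj n) fun x => (hB n x).1
    rw [← (hB n 0).1, (List.append_eq_nil_iff.1 h0).1, List.length_nil] at h₁
    exact lt_irrefl _ h₁
  choose T hT hTne using hT
  obtain ⟨w, hw0, hw, hwU, hwe, C, hC⟩ := exists_coding
    (fun i j hij => OrientedMultigraph.NBStep.mono (hUanti hij)) hT₀ hT hTne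
    (NNReal.coe_pos.2 hs0) hLm hBinj hB
  rw [hU0] at hw
  have hsrc : ∀ x, Γ.src (w x 0) = quotientVertex X G o := fun x => by rw [hw0, hf]
  refine le_dimH_of_coding hs0 (fun x => liftRay hX hact (w x) (hsrc x) (hw x)) (fun x => ⟨?_, ?_⟩)
    (C + s) fun x y hxy => ?_
  · refine liftRay_mem_limitSet hX hact _ _ fun N => ?_
    obtain ⟨i, hi, n, hn⟩ := hwe x N
    exact ⟨i, hi, hn ▸ hbase n _ (herev n)⟩
  · refine notMem_conicalLimitSet hX.connected hact fun R => ?_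
    obtain ⟨N, hN⟩ := hwU (R + 1)
    refine ⟨N, fun k hk y hy heq => ?_⟩
    have h₁ := (hN x k hk).1
    have h₂ := liesOver_liftWalk hact (hsrc x) (fun j _ => hw x j) (le_refl k)
    rw [h₂.src] at h₁
    exact Set.disjoint_left.1 (hUdisj R) h₁ ⟨y, hy, heq.symm⟩
  · obtain ⟨b, i, hb, hi, hsi⟩ := hC x y hxy
    refine ⟨b, i + 1, hb, liftRay_vertex_ne hX hact _ _ _ _ hi, ?_⟩
    push_cast
    linarith
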